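/- **System.** A base station with $L\ge 2$ antennas and transmit power $p>0$ serves two single-antenna users $k\in\{1,2\}$ by rate splitting, with power-allocation factors $\alpha_c,\alpha_1,\alpha_2>0$, $\alpha_c+\alpha_1+\alpha_2=1$, while a backscatter device with efficiency $\eta\in(0,1]$ and reflection coefficient $\delta\in(0,1]$ reflects the signal. The noise variance is $\sigma^2>0$ and $\Psi=p/\sigma^2$. The channels $\boldsymbol h_0,\boldsymbol h_1,\boldsymbol h_2\in\mathbb C^L$ (base station to backscatter device and to the users) and $g_1,g_2\in\mathbb C$ (backscatter device to the users) have jointly independent entries (Rayleigh fading): $|h_{0,l}|^2$, $|h_{k,l}|^2$ and $|g_k|^2$ are exponentially distributed with rates $\lambda_0,\lambda_k,\Omega_k>0$. Put $\tau_k=\|\boldsymbol h_k\|^2$ and $\tau_0=|\theta|^2$, where $\theta$ is the gain-control factor. With target rates $R_c,R_1,R_2,R_b>0$ put $\bar\gamma_c=2^{R_c}-1$, $\bar\gamma_k=2^{R_k}-1$, $\bar\gamma_b=2^{R_b}-1$, and let $$\gamma_{k,c}=\frac{\alpha_c\Psi\tau_k}{\alpha_k\Psi\tau_k+\eta\delta\Psi|\theta|^2|g_k|^2+1},\quad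 \gamma_{k,k}=\frac{\alpha_k\Psi\tau_k}{\eta\delta\Psi|\theta|^2|g_k|^2+1},\quad \gamma_{k,b}=\eta\delta\Psi|\theta|^2|g_k|^2 .$$ The symbiotic outage probability $\mathrm{SOP}$ is the probability that no $\delta\in(0,1]$ satisfies $\gamma_{k,c}>\bar\gamma_c$, $\gamma_{k,k}>\bar\gamma_k$ and $\gamma_{k,b}>\bar\gamma_b$ for both $k=1,2$. Put $\rho_{c,k}=(\alpha_c-\bar\gamma_c\alpha_k)/\bar\gamma_c$ and $\rho_k=\alpha_k/\bar\gamma_k$, and assume $\rho_{c,k}>0$ for $k=1,2$. Let $$\pi_k=\max\{1/\rho_k,1/\rho_{c,k}\},\quad \beta_0=\frac{\bar\gamma_b\lambda_0}{\eta\Psi},\quad \beta_k=\frac{\lambda_k\pi_k\bar\gamma_b}{\Psi\Omega_k},\quad \beta_{j,k}=\Omega_j+\Omega_k,\quad \chi_k=\frac{\beta_k\Omega_k(\bar\gamma_b+1)}{\bar\gamma_b},$$ and let $\Gamma(a,x)=\int_x^\infty t^{a-1}e^{-t}\,dt$. For integers $m\ge0$, $0\le q\le n$ and $x,y>0$ let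 $$\mathcal H_{m,n,q}(x,y)=\mathrm H^{0,1;1,1;0,1}_{1,0;1,1;1,0}\left(\begin{matrix}m-1;1,1\\-\end{matrix}\;\middle|\;\begin{matrix}(q-n,1)\\(0,1)\end{matrix}\;\middle|\;\begin{matrix}(1,1)\\-\end{matrix}\;\middle|\;x;y\right)$$ denote the bivariate Fox H-function, i.e. the double Mellin–Barnes integral $$\frac1{(2\pi i)^2}\int_{c_1-i\infty}^{c_1+i\infty}\int_{c_2-i\infty}^{c_2+i\infty}\Gamma(2-m+s+t)\,\Gamma(n-q+1+s)\,\Gamma(-s)\,\Gamma(t)\,x^s y^t\,dt\,ds$$ along vertical lines that separate the poles ($-(n-q+1)<c_1<0$, $c_2>0$, $c_1+c_2>m-2$). **Theorem.** Suppose that $\theta$ is real and independent of $(\boldsymbol h_1,\boldsymbol h_2,g_1,g_2)$ and that $\tau_0=|\theta|^2$ has the gamma distribution function $$F_{\tau_0}(z)=1-\frac{\Gamma(L,\lambda_0z)}{(L-1)!},\qquad z\ge0,$$ which is the distribution taken for the composite channel selection (CCS) gain; for instance $|\theta|^2=\sum_l|h_{0,l}|^2$. Then $$\mathrm{SOP}=1-\Pr\Big[\max_k\frac{\bar\gamma_b}{\eta\Psi\tau_0|g_k|^2}<\min\Big\{1,\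 \min_k\frac{\rho_{c,k}\Psi\tau_k-1}{\eta\Psi\tau_0|g_k|^2},\ \min_k\frac{\rho_k\Psi\tau_k-1}{\eta\Psi\tau_0|g_k|^2}\Big\}\Big],$$ and $$\mathrm{SOP}=1-\sum_{(j,k)\in\{(1,2),(2,1)\}}\ \sum_{m=0}^{L-1}\sum_{n=0}^{L-1}\sum_{q=0}^{n}\frac{\Omega_j\,\beta_0^m\,\chi_k^q\,e^{-\chi_k}\,\beta_{j,k}^{m-2}}{m!\,q!\,\beta_k\,\Gamma(n-q+1)}\;\mathcal H_{m,n,q}\Big(\frac1{\beta_k\beta_{j,k}},\frac1{\beta_0\beta_{j,k}}\Big)\,\frac{1}{(L-1)!}\,\Gamma\Big(L,(\bar\gamma_b+1)\frac{\lambda_j\pi_j}{\Psi}\Big),$$ where all the double Mellin–Barnes integrals converge absolutely and do not depend on the choice of the separating lines. -/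

import Mathlib

open MeasureTheory ProbabilityTheory

noncomputable section

/-! ### Special functions -/

/-- The upper incomplete Gamma function `Γ(a, x) = ∫_x^∞ t^(a-1) e^(-t) dt`. -/
def upperGamma (a x : ℝ) : ℝ :=
  ∫ t in Set.Ioi x, t ^ (a - 1) * Real.exp (-t)

/-- Parameters of a one-variable block `m, n; p, q` of a Fox H-function: the upper list
`(c_j, γ_j)`, `1 ≤ j ≤ p`, the lower list `(d_j, δ_j)`, `1 ≤ j ≤ q`, and the numbers `m ≤ q`,
`n ≤ p` of lower and upper parameters that contribute to the numerator. The `γ_j`, `δ_j` are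
positive. -/
structure FoxBlock where
  m : ℕ
  n : ℕ
  upper : List (ℂ × ℝ)
  lower : List (ℂ × ℝ)

/-- The kernel
`∏_{j ≤ m} Γ(d_j - δ_j ξ) ∏_{j ≤ n} Γ(1 - c_j + γ_j ξ) /
  (∏_{j > m} Γ(1 - d_j + δ_j ξ) ∏_{j > n} Γ(c_j - γ_j ξ))`. -/
def FoxBlock.kernel (B : FoxBlock) (ξ : ℂ) : ℂ :=
  (((B.lower.take B.m).map fun d => Complex.Gamma (d.1 - d.2 * ξ)).prod *
    ((B.upper.take B.n).map fun c => Complex.Gamma (1 - c.1 + c.2 * ξ)).prod) /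
  (((B.lower.drop B.m).map fun d => Complex.Gamma (1 - d.1 + d.2 * ξ)).prod *
    ((B.upper.drop B.n).map fun c => Complex.Gamma (c.1 - c.2 * ξ)).prod)

/-- Parameters of the generalized bivariate Fox H-function
`H^{0, n₁; m₂, n₂; m₃, n₃}_{p₁, q₁; p₂, q₂; p₃, q₃}`: the joint block has the upper list
`(a_j; α_j, A_j)`, `1 ≤ j ≤ p₁`, and the lower list `(b_j; β_j, B_j)`, `1 ≤ j ≤ q₁`; the other two
blocks belong to the first and to the second variable. -/
structure BivariateFoxParams where
  n₁ : ℕ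
  upper : List (ℂ × ℝ × ℝ)
  lower : List (ℂ × ℝ × ℝ)
  fst : FoxBlock
  snd : FoxBlock

namespace BivariateFoxParams

/-- The joint kernel
`∏_{j ≤ n₁} Γ(1 - a_j + α_j ξ + A_j ζ) /
  (∏_{j > n₁} Γ(a_j - α_j ξ - A_j ζ) ∏_j Γ(1 - b_j + β_j ξ + B_j ζ))`. -/
def jointKernel (P : BivariateFoxParams) (ξ ζ : ℂ) : ℂ :=
  ((P.upper.take P.n₁).map fun a => Complex.Gamma (1 - a.1 + a.2.1 * ξ + a.2.2 * ζ)).prod /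
  (((P.upper.drop P.n₁).map fun a => Complex.Gamma (a.1 - a.2.1 * ξ - a.2.2 * ζ)).prod *
    (P.lower.map fun b => Complex.Gamma (1 - b.1 + b.2.1 * ξ + b.2.2 * ζ)).prod)

/-- The integrand of the double Mellin–Barnes integral. -/
def integrand (P : BivariateFoxParams) (x y ξ ζ : ℂ) : ℂ :=
  P.jointKernel ξ ζ * P.fst.kernel ξ * P.snd.kernel ζ * x ^ ξ * y ^ ζ

/-- The lines `Re ξ = c.1` and `Re ζ = c.2` separate the poles of the integrand: those of the
`Γ(d_j - δ_j ξ)`, `j ≤ m₂`, lie to the right of the first line, those of the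
`Γ(1 - c_j + γ_j ξ)`, `j ≤ n₂`, and of the `Γ(1 - a_j + α_j ξ + A_j ζ)`, `j ≤ n₁`, to its left;
likewise for the second variable. -/
def Separates (P : BivariateFoxParams) (c : ℝ × ℝ) : Prop :=
  (∀ a ∈ P.upper.take P.n₁, 0 < 1 - a.1.re + a.2.1 * c.1 + a.2.2 * c.2) ∧
  (∀ d ∈ P.fst.lower.take P.fst.m, 0 < d.1.re - d.2 * c.1) ∧
  (∀ u ∈ P.fst.upper.take P.fst.n, 0 < 1 - u.1.re + u.2 * c.1) ∧
  (∀ d ∈ P.snd.lower.take P.snd.m, 0 < d.1.re - d.2 * c.2) ∧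
  (∀ u ∈ P.snd.upper.take P.snd.n, 0 < 1 - u.1.re + u.2 * c.2)

/-- The integrand on the pair of vertical lines `ξ = c.1 + i s`, `ζ = c.2 + i t`. -/
def onLines (P : BivariateFoxParams) (x y : ℂ) (c : ℝ × ℝ) (p : ℝ × ℝ) : ℂ :=
  P.integrand x y (c.1 + p.1 * Complex.I) (c.2 + p.2 * Complex.I)

/-- `v` is the value at `(x, y)` of the bivariate Fox H-function, i.e. of
`(2πi)⁻² ∫ ∫ integrand dξ dζ` along separating vertical lines (`dξ dζ = i² ds dt`): such lines
exist, and along any of them the double integral converges absolutely, with value `v`. -/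
def HasValue (P : BivariateFoxParams) (x y v : ℂ) : Prop :=
  (∃ c, P.Separates c) ∧
  ∀ c, P.Separates c → Integrable (P.onLines x y c) ∧
    1 / (2 * (Real.pi : ℂ)) ^ 2 * ∫ p : ℝ × ℝ, P.onLines x y c p = v

open Classical in
/-- The bivariate Fox H-function (`0` where it has no value). -/
def foxH (P : BivariateFoxParams) (x y : ℂ) : ℂ :=
  if h : ∃ v, P.HasValue x y v then h.choose else 0

end BivariateFoxParams

/-- The parameters of the function `H^{0,1;1,1;0,1}_{1,0;1,1;1,0}` with joint upper parameter
`(m-1; 1, 1)`, first block with upper parameter `(q-n, 1)` and lower parameter `(0, 1)`, second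
block with upper parameter `(1, 1)`. -/
def sopFoxParams (m n q : ℕ) : BivariateFoxParams where
  n₁ := 1
  upper := [((m : ℂ) - 1, 1, 1)]
  lower := []
  fst := { m := 1, n := 1, upper := [((q : ℂ) - n, 1)], lower := [(0, 1)] }
  snd := { m := 0, n := 1, upper := [(1, 1)], lower := [] }

/-! ### The symbiotic backscatter RSMA system -/

/-- Parameters of the system. The cellular users `1, 2` are indexed by `0, 1 : Fin 2`. -/
structure SymbioticRSMA where
  /-- number of antennas of the base station -/
  L : ℕ
  /-- transmit power -/
  p : ℝ
  /-- noise variance -/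
  noise : ℝ
  /-- backscatter efficiency -/
  η : ℝ
  /-- power allocation factor of the common stream -/
  αc : ℝ
  /-- power allocation factors of the private streams -/
  α : Fin 2 → ℝ
  /-- target rate of the common stream -/
  Rc : ℝ
  /-- target rates of the private streams -/
  R : Fin 2 → ℝ
  /-- target rate of the backscattered stream -/
  Rb : ℝ
  /-- fading parameter of the link from the base station to the backscatter device -/
  lam0 : ℝ
  /-- fading parameters of the links from the base station to the users -/
  lam : Fin 2 → ℝ
  /-- fading parameters of the links from the backscatter device to the users -/
  Om : Fin 2 → ℝ

namespace SymbioticRSMA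

variable (S : SymbioticRSMA)

/-- average signal-to-noise ratio -/
def Ψ : ℝ := S.p / S.noise
/-- decoding threshold of the common stream -/
def γc : ℝ := 2 ^ S.Rc - 1
/-- decoding thresholds of the private streams -/
def γp (k : Fin 2) : ℝ := 2 ^ S.R k - 1
/-- decoding threshold of the backscattered stream -/
def γb : ℝ := 2 ^ S.Rb - 1

/-- `ρ_{c,k}` -/
def ρc (k : Fin 2) : ℝ := (S.αc - S.γc * S.α k) / S.γc
/-- `ρ_k` -/
def ρ (k : Fin 2) : ℝ := S.α k / S.γp k
/-- `π_k` -/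
def piMax (k : Fin 2) : ℝ := max (1 / S.ρ k) (1 / S.ρc k)
/-- `β_0` -/
def β0 : ℝ := S.γb * S.lam0 / (S.η * S.Ψ)
/-- `β_k` -/
def β (k : Fin 2) : ℝ := S.lam k * S.piMax k * S.γb / (S.Ψ * S.Om k)
/-- `β_{j,k}` -/
def βsum (j k : Fin 2) : ℝ := S.Om j + S.Om k
/-- `χ_k` -/
def χ (k : Fin 2) : ℝ := S.β k * S.Om k * (S.γb + 1) / S.γb

/-- The standing assumptions on the parameters. The last one, i.e. `ρ_{c,k} > 0`, says that the
common stream can be decoded at all. -/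
structure Admissible : Prop where
  two_le_L : 2 ≤ S.L
  p_pos : 0 < S.p
  noise_pos : 0 < S.noise
  η_pos : 0 < S.η
  η_le : S.η ≤ 1
  αc_pos : 0 < S.αc
  α_pos : ∀ k, 0 < S.α k
  α_sum : S.αc + ∑ k, S.α k = 1
  Rc_pos : 0 < S.Rc
  R_pos : ∀ k, 0 < S.R k
  Rb_pos : 0 < S.Rb
  lam0_pos : 0 < S.lam0
  lam_pos : ∀ k, 0 < S.lam k
  Om_pos : ∀ k, 0 < S.Om k
  common_decodable : ∀ k, S.γc * S.α k < S.αc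

/-- The distribution function `z ↦ 1 - Γ(L, ℓ z) / (L-1)!`, `z ≥ 0`, with parameter `ℓ`. -/
def gammaCDF (ℓ z : ℝ) : ℝ := 1 - upperGamma S.L (ℓ * z) / (S.L - 1).factorial

/-! #### SINRs and outage
In the next definitions `δ` is the reflection coefficient, `θ` the gain-control factor,
`τ = ‖h_k‖²` and `G = |g_k|²`. -/

/-- SINR `γ_{k,c}` for decoding the common stream at user `k` -/
def sinrCommon (k : Fin 2) (δ θ τ G : ℝ) : ℝ :=
  S.αc * S.Ψ * τ / (S.α k * S.Ψ * τ + S.η * δ * S.Ψ * |θ| ^ 2 * G + 1)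
/-- SINR `γ_{k,k}` for decoding the private stream at user `k` -/
def sinrPrivate (k : Fin 2) (δ θ τ G : ℝ) : ℝ :=
  S.α k * S.Ψ * τ / (S.η * δ * S.Ψ * |θ| ^ 2 * G + 1)
/-- SINR `γ_{k,b}` for decoding the backscattered stream -/
def sinrBackscatter (δ θ G : ℝ) : ℝ :=
  S.η * δ * S.Ψ * |θ| ^ 2 * G

/-- All decoding conditions of the successive interference cancellation hold at user `k`. -/
def SICRule (k : Fin 2) (δ θ τ G : ℝ) : Prop :=
  S.γc < S.sinrCommon k δ θ τ G ∧ S.γp k < S.sinrPrivate k δ θ τ G ∧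
    S.γb < S.sinrBackscatter δ θ G

/-- The element of `δ_low` that belongs to a user -/
def deltaLow (θ G : ℝ) : ℝ := S.γb / (S.η * S.Ψ * |θ| ^ 2 * G)
/-- The smaller one of the two elements of `δ_up` that belong to user `k` -/
def deltaUp (k : Fin 2) (θ τ G : ℝ) : ℝ :=
  min ((S.ρc k * S.Ψ * τ - 1) / (S.η * S.Ψ * |θ| ^ 2 * G))
    ((S.ρ k * S.Ψ * τ - 1) / (S.η * S.Ψ * |θ| ^ 2 * G))

variable {W : Type*}

/-- `τ_k = ‖h_k‖²` -/
def gain {L : ℕ} (h : Fin L → W → ℂ) (w : W) : ℝ := ∑ l, ‖h l w‖ ^ 2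

/-- The symbiotic outage probability: the probability that no reflection coefficient in `(0, 1]`
makes the decoding conditions hold at both users. -/
def sop [MeasurableSpace W] (μ : Measure W) (h : Fin 2 → Fin S.L → W → ℂ) (g : Fin 2 → W → ℂ)
    (θ : W → ℝ) : ℝ :=
  μ.real {w | ¬ ∃ δ ∈ Set.Ioc (0 : ℝ) 1,
    ∀ k, S.SICRule k δ (θ w) (gain (h k) w) (‖g k w‖ ^ 2)}

/-- The event `max δ_low < min {1, δ_up}` -/
def reflectionRangeNonempty (h : Fin 2 → Fin S.L → W → ℂ) (g : Fin 2 → W → ℂ)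
    (θ : W → ℝ) : Set W :=
  {w | max (S.deltaLow (θ w) (‖g 0 w‖ ^ 2)) (S.deltaLow (θ w) (‖g 1 w‖ ^ 2)) <
    min 1 (min (S.deltaUp 0 (θ w) (gain (h 0) w) (‖g 0 w‖ ^ 2))
      (S.deltaUp 1 (θ w) (gain (h 1) w) (‖g 1 w‖ ^ 2)))}

/-- The triple sum for the ordered pair `(j, k)` of users. -/
def tripleSum (j k : Fin 2) : ℂ :=
  ∑ m ∈ Finset.range S.L, ∑ n ∈ Finset.range S.L, ∑ q ∈ Finset.range (n + 1),
    ((S.Om j * S.β0 ^ m * S.χ k ^ q * Real.exp (-S.χ k) * S.βsum j k ^ ((m : ℤ) - 2) /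
        (m.factorial * q.factorial * S.β k * Real.Gamma ((n : ℝ) - q + 1)) : ℝ) : ℂ) *
      (sopFoxParams m n q).foxH ((1 / (S.β k * S.βsum j k) : ℝ) : ℂ)
        ((1 / (S.β0 * S.βsum j k) : ℝ) : ℂ) *
      ((1 / (S.L - 1).factorial *
        upperGamma S.L ((S.γb + 1) * (S.lam j * S.piMax j / S.Ψ)) : ℝ) : ℂ)

/-- The closed form of the symbiotic outage probability. -/
def closedForm : ℂ := 1 - S.tripleSum 0 1 - S.tripleSum 1 0

end SymbioticRSMA

end

/-!
The outage event is decoded into constraints on the channel gains: a reflection coefficient that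
works for both users exists exactly when the range between the lower and the upper bounds that the
users impose on it is nonempty (`Admissible.exists_sicRule_iff`). Up to the null event
`|g_1|² = |g_2|²` this event splits according to the user `j` with the weaker backscatter link. That
user fixes the lower bound `γ_b / (η Ψ |θ|² |g_j|²)`, and what remains is
`|θ|² > γ_b / (η Ψ |g_j|²)`, `τ_j > π_j (γ_b + 1) / Ψ` and
`τ_k > π_k (1 + γ_b |g_k|² / |g_j|²) / Ψ` (`Admissible.range_nonempty_iff`).

The gains `τ_j`, `τ_k` and `|θ|²` are gamma variables with integer shape, whose tail functions are
`e^{-x} ∑_{i<L} x^i / i!` (`erlangTail`), because adding an independent exponential variable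
integrates this tail once (`measure_lt_add_of_exp`). Integrating them out
(`measure_ordered_constraints`) leaves a double integral over `x = |g_j|² < y = |g_k|²`. By the
binomial theorem the inner one is a sum of elementary integrals, and the outer one becomes a sum of
integrals of `x^{1-m} e^{-β_{jk} x} (1 + x / β_k)^{-(n-q+1)} e^{-β_0/x}`
(`lintegral_exp_mul_erlangTail_mul`).

On the other side, the bivariate Fox H-function reduces to the same integral
(`sopFoxParams_hasValue`). Euler's integral for the joint factor `Γ(2 - m + ξ + ζ)` separates the
two Mellin–Barnes integrals by Fubini's theorem (`integral_mul_Gamma`). The one in `ζ` is the Mellin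
inversion of the exponential function, and the one in `ξ` is a binomial, which follows from the same
inversion after a second use of Euler's integral (`integral_Gamma_mul_Gamma_neg`). Fubini's theorem
applies, and the double integral converges absolutely along all separating lines, because `Γ` is
bounded and integrable on vertical lines in the right half plane (`integrable_Gamma_vertical`).
-/

/-! ### Mellin–Barnes integrals of Gamma functions -/

open Complex in
theorem norm_Gamma_le {z : ℂ} (hz : 0 < z.re) : ‖Gamma z‖ ≤ Real.Gamma z.re := by
  rw [Gamma_eq_integral hz, Real.Gamma_eq_integral hz]
  refine (norm_integral_le_integral_norm _).trans_eq ?_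
  refine setIntegral_congr_fun measurableSet_Ioi fun t (ht : 0 < t) => ?_
  simp only [norm_mul, norm_cpow_eq_rpow_re_of_pos ht, sub_re, one_re, norm_real,
    Real.norm_eq_abs, abs_of_pos (Real.exp_pos _)]

theorem continuous_Gamma_vertical {c : ℝ} (hc : 0 < c) :
    Continuous fun t : ℝ => Complex.Gamma (c + t * Complex.I) := by
  refine continuous_iff_continuousAt.2 fun t => ?_
  have h1 : ContinuousAt Complex.Gamma ((c : ℂ) + t * Complex.I) := by
    refine (Complex.differentiableAt_Gamma _ fun m h => ?_).continuousAt
    have := congrArg Complex.re h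
    simp at this
    have : (0 : ℝ) ≤ m := m.cast_nonneg
    linarith
  exact ContinuousAt.comp (f := fun t : ℝ => (c : ℂ) + t * Complex.I) h1 (by fun_prop)

/-- `Γ` is integrable along the vertical lines in the right half plane: there
`Γ(z) = Γ(z + 2) / (z (z + 1))`, where the numerator is bounded. -/
theorem integrable_Gamma_vertical {c : ℝ} (hc : 0 < c) :
    Integrable fun t : ℝ => Complex.Gamma (c + t * Complex.I) := by
  have hre : ∀ t : ℝ, ((c : ℂ) + t * Complex.I).re = c := fun t => by simp
  have him : ∀ t : ℝ, ((c : ℂ) + t * Complex.I).im = t := fun t => by simp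
  set k : ℝ := min 1 (c ^ 2) with hk
  have hk0 : 0 < k := by positivity
  refine Integrable.mono' (integrable_inv_one_add_sq.const_mul (Real.Gamma (c + 2) * k⁻¹))
    (continuous_Gamma_vertical hc).aestronglyMeasurable (Filter.Eventually.of_forall fun t => ?_)
  set z : ℂ := c + t * Complex.I with hz
  have hz0 : z ≠ 0 := fun h => by have := hre t; rw [← hz, h] at this; simp at this; linarith
  have hz1 : z + 1 ≠ 0 := fun h => by
    have h2 := congrArg Complex.re h
    rw [Complex.add_re, hz, hre t] at h2; simp at h2; linarith
  have hG : Complex.Gamma (z + 2) = (z + 1) * (z * Complex.Gamma z) := by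
    rw [← Complex.Gamma_add_one z hz0, ← Complex.Gamma_add_one (z + 1) hz1]
    ring_nf
  have hb : ‖Complex.Gamma (z + 2)‖ ≤ Real.Gamma (c + 2) := by
    have h3 : (z + 2).re = c + 2 := by rw [Complex.add_re, hz, hre t]; simp
    rw [← h3]; exact norm_Gamma_le (by rw [h3]; linarith)
  have hn0 : ‖z‖ ^ 2 = c ^ 2 + t ^ 2 := by
    rw [← Complex.normSq_eq_norm_sq, Complex.normSq_apply, hz, hre, him]; ring
  have hle : ‖z‖ ≤ ‖z + 1‖ := by
    rw [← sq_le_sq₀ (norm_nonneg _) (norm_nonneg _), ← Complex.normSq_eq_norm_sq,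
      ← Complex.normSq_eq_norm_sq, Complex.normSq_apply, Complex.normSq_apply]
    simp only [Complex.add_re, Complex.add_im, Complex.one_re, Complex.one_im, hz, hre, him]
    nlinarith
  have hmain : k * (1 + t ^ 2) * ‖Complex.Gamma z‖ ≤ Real.Gamma (c + 2) := by
    refine le_trans ?_ hb
    rw [hG, norm_mul, norm_mul, ← mul_assoc]
    refine mul_le_mul_of_nonneg_right ?_ (norm_nonneg _)
    calc k * (1 + t ^ 2) ≤ c ^ 2 + t ^ 2 := by
          have := min_le_left 1 (c ^ 2); have := min_le_right 1 (c ^ 2)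
          nlinarith [sq_nonneg t]
      _ = ‖z‖ * ‖z‖ := by rw [← hn0]; ring
      _ ≤ ‖z + 1‖ * ‖z‖ := by gcongr
  rw [mul_assoc, ← mul_inv, ← div_eq_mul_inv, le_div_iff₀ (by positivity)]
  linarith

theorem norm_cpow_vertical {x : ℝ} (hx : 0 < x) (c t : ℝ) :
    ‖(x : ℂ) ^ ((c : ℂ) + t * Complex.I)‖ = x ^ c := by
  rw [Complex.norm_cpow_eq_rpow_re_of_pos hx]; simp

theorem measurable_cpow_vertical (x c : ℝ) :
    Measurable fun t : ℝ => (x : ℂ) ^ ((c : ℂ) + t * Complex.I) :=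
  Measurable.pow measurable_const (by fun_prop)

theorem integrable_Gamma_mul_cpow {c x : ℝ} (hc : 0 < c) (hx : 0 < x) :
    Integrable fun t : ℝ =>
      Complex.Gamma (c + t * Complex.I) * (x : ℂ) ^ ((c : ℂ) + t * Complex.I) :=
  (integrable_Gamma_vertical hc).mul_bdd (c := x ^ c) (measurable_cpow_vertical x c).aestronglyMeasurable
    (Filter.Eventually.of_forall fun t => (norm_cpow_vertical hx c t).le)

/-- Mellin inversion for the exponential function: `(2πi)⁻¹ ∫ Γ(ζ) x^ζ dζ = e^{-1/x}`. -/
theorem integral_Gamma_mul_cpow {c x : ℝ} (hc : 0 < c) (hx : 0 < x) :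
    ∫ t : ℝ, Complex.Gamma (c + t * Complex.I) * (x : ℂ) ^ ((c : ℂ) + t * Complex.I) =
      (2 * Real.pi * Real.exp (-x⁻¹) : ℝ) := by
  have hmel : ∀ z : ℂ, 0 < z.re → mellin (fun t : ℝ => (Real.exp (-t) : ℂ)) z = Complex.Gamma z := by
    intro z hz
    rw [Complex.Gamma_eq_integral hz, Complex.GammaIntegral_eq_mellin]
  have hline : ∀ t : ℝ, mellin (fun t : ℝ => (Real.exp (-t) : ℂ)) (c + t * Complex.I) =
      Complex.Gamma (c + t * Complex.I) := fun t => hmel _ (by simpa using hc)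
  have hconv : MellinConvergent (fun t : ℝ => (Real.exp (-t) : ℂ)) (c : ℂ) := by
    have := Complex.GammaIntegral_convergent (s := (c : ℂ)) (by simpa using hc)
    refine this.congr_fun (fun t _ => ?_) measurableSet_Ioi
    simp [mul_comm]
  have hinv := mellinInv_mellin_eq c (fun t : ℝ => (Real.exp (-t) : ℂ)) (inv_pos.2 hx) hconv
    (by simpa only [Complex.VerticalIntegrable, hline] using integrable_Gamma_vertical hc)
    (by fun_prop)
  rw [mellinInv] at hinv
  simp only [hline] at hinv
  have hpow : ∀ t : ℝ, ((x⁻¹ : ℝ) : ℂ) ^ (-((c : ℂ) + t * Complex.I)) =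
      (x : ℂ) ^ ((c : ℂ) + t * Complex.I) := by
    intro t
    rw [Complex.cpow_neg, Complex.ofReal_inv, Complex.inv_cpow _ _ (by
      rw [Complex.arg_ofReal_of_nonneg hx.le]; exact Real.pi_pos.ne), inv_inv]
  simp only [hpow, smul_eq_mul] at hinv
  rw [Complex.ofReal_mul, ← hinv, Complex.real_smul]
  simp only [mul_comm (Complex.Gamma _)]
  push_cast
  rw [← mul_assoc, mul_one_div_cancel (by simp), one_mul]

/-- The reflected form `(2πi)⁻¹ ∫ Γ(-ξ) x^ξ dξ = e^{-x}` of Mellin inversion. -/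
theorem integral_Gamma_neg_mul_cpow {c x : ℝ} (hc : c < 0) (hx : 0 < x) :
    ∫ t : ℝ, Complex.Gamma (-(c + t * Complex.I)) * (x : ℂ) ^ ((c : ℂ) + t * Complex.I) =
      (2 * Real.pi * Real.exp (-x) : ℝ) := by
  have h := integral_Gamma_mul_cpow (neg_pos.2 hc) (inv_pos.2 hx)
  rw [inv_inv, ← integral_neg_eq_self] at h
  rw [← h]
  refine integral_congr_ae (Filter.Eventually.of_forall fun t => ?_)
  have e : ((-c : ℝ) : ℂ) + ((-t : ℝ) : ℂ) * Complex.I = -((c : ℂ) + t * Complex.I) := by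
    push_cast; ring
  simp only [e]
  rw [Complex.cpow_neg, Complex.ofReal_inv, Complex.inv_cpow _ _ (by
      rw [Complex.arg_ofReal_of_nonneg hx.le]; exact Real.pi_pos.ne), inv_inv]

theorem integrable_Gamma_neg_mul_cpow {c x : ℝ} (hc : c < 0) (hx : 0 < x) :
    Integrable fun t : ℝ =>
      Complex.Gamma (-(c + t * Complex.I)) * (x : ℂ) ^ ((c : ℂ) + t * Complex.I) := by
  refine Integrable.mul_bdd (c := x ^ c) ?_ (measurable_cpow_vertical x c).aestronglyMeasurable
    (Filter.Eventually.of_forall fun t => (norm_cpow_vertical hx c t).le)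
  refine (integrable_Gamma_vertical (neg_pos.2 hc)).comp_neg.congr
    (Filter.Eventually.of_forall fun t => ?_)
  simp only
  congr 1
  push_cast; ring

section Fubini

variable {α : Type*} [MeasurableSpace α] {ν : Measure α} {g : α → ℂ} {φ : α → ℝ}
  {c : ℝ}

theorem cpow_add_mul_I {u : ℝ} (hu : 0 < u) (c t : ℝ) :
    (u : ℂ) ^ ((c : ℂ) + t * Complex.I) = ((u ^ c : ℝ) : ℂ) * (u : ℂ) ^ (t * Complex.I) := by
  rw [Complex.cpow_add _ _ (by exact_mod_cast hu.ne'), Complex.ofReal_cpow hu.le]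

theorem integrable_mul_Gamma (hc : 0 < c) (hg : Integrable g ν) (hφ : Measurable φ) :
    Integrable (fun x => g x * Complex.Gamma (c + φ x * Complex.I)) ν := by
  refine hg.mul_bdd (c := Real.Gamma c) ?_ (Filter.Eventually.of_forall fun x => ?_)
  · exact ((continuous_Gamma_vertical hc).measurable.comp hφ).aestronglyMeasurable
  · have h := norm_Gamma_le (z := c + φ x * Complex.I) (by simpa using hc)
    simpa using h

/-- Fubini's theorem for a Mellin–Barnes integrand with a factor `Γ(c + i φ)`, which is replaced by
its Euler integral. -/
theorem integral_mul_Gamma [SFinite ν] (hc : 0 < c) (hg : Integrable g ν) (hφ : Measurable φ) :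
    ∫ x, g x * Complex.Gamma (c + φ x * Complex.I) ∂ν =
      ∫ u in Set.Ioi (0 : ℝ), ((u ^ (c - 1) * Real.exp (-u) : ℝ) : ℂ) *
        ∫ x, g x * (u : ℂ) ^ (φ x * Complex.I) ∂ν := by
  have hE : IntegrableOn (fun u : ℝ => ((u ^ (c - 1) * Real.exp (-u) : ℝ) : ℂ)) (Set.Ioi 0) := by
    have := (Real.GammaIntegral_convergent hc).ofReal (𝕜 := ℂ)
    exact this.congr (Filter.Eventually.of_forall fun u => by simp [mul_comm])
  have hint : Integrable (Function.uncurry fun (x : α) (u : ℝ) =>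
      g x * ((u ^ (c - 1) * Real.exp (-u) : ℝ) : ℂ) * (u : ℂ) ^ (φ x * Complex.I))
      (ν.prod (volume.restrict (Set.Ioi 0))) := by
    refine (hg.mul_prod hE).mul_bdd (c := 1) ?_ ?_
    · refine Measurable.aestronglyMeasurable (Measurable.pow ?_ ?_)
      · fun_prop
      · fun_prop
    · have h0 : ∀ᵐ z ∂(ν.prod (volume.restrict (Set.Ioi (0:ℝ)))), 0 < z.2 :=
        Measure.quasiMeasurePreserving_snd.ae (ae_restrict_mem measurableSet_Ioi)
      filter_upwards [h0] with z hz
      rw [Complex.norm_cpow_eq_rpow_re_of_pos hz]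
      simp
  calc ∫ x, g x * Complex.Gamma (c + φ x * Complex.I) ∂ν
      = ∫ x, ∫ u : ℝ in Set.Ioi 0, g x * ((u ^ (c - 1) * Real.exp (-u) : ℝ) : ℂ) *
          (u : ℂ) ^ (φ x * Complex.I) ∂volume ∂ν := by
        refine integral_congr_ae (Filter.Eventually.of_forall fun x => ?_)
        simp only
        rw [Complex.Gamma_eq_integral (by simpa using hc), Complex.GammaIntegral,
          ← integral_const_mul]
        refine setIntegral_congr_fun measurableSet_Ioi fun u (hu : 0 < u) => ?_
        have e : (c : ℂ) + φ x * Complex.I - 1 = ((c - 1 : ℝ) : ℂ) + φ x * Complex.I := by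
          push_cast; ring
        rw [e, cpow_add_mul_I hu]
        push_cast
        ring
    _ = _ := by
        rw [integral_integral_swap hint]
        refine integral_congr_ae (Filter.Eventually.of_forall fun u => ?_)
        dsimp only
        rw [← integral_const_mul]
        refine integral_congr_ae (Filter.Eventually.of_forall fun x => ?_)
        dsimp only
        ring

end Fubini

/-- The Mellin–Barnes integral of a binomial,
`(2πi)⁻¹ ∫ Γ(b + ξ) Γ(-ξ) z^ξ dξ = Γ(b) (1 + z)^{-b}`. -/
theorem integral_Gamma_mul_Gamma_neg {b c z : ℝ} (hc : c < 0) (hbc : 0 < b + c) (hz : 0 < z) :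
    ∫ t : ℝ, Complex.Gamma (-(c + t * Complex.I)) * (z : ℂ) ^ ((c : ℂ) + t * Complex.I) *
        Complex.Gamma ((b + c : ℝ) + t * Complex.I) =
      (2 * Real.pi * (Real.Gamma b * (1 + z) ^ (-b)) : ℝ) := by
  refine (integral_mul_Gamma hbc (integrable_Gamma_neg_mul_cpow hc hz) measurable_id).trans ?_
  have h1 : ∀ u ∈ Set.Ioi (0 : ℝ), ((u ^ (b + c - 1) * Real.exp (-u) : ℝ) : ℂ) *
      ∫ t : ℝ, Complex.Gamma (-(c + t * Complex.I)) * (z : ℂ) ^ ((c : ℂ) + t * Complex.I) *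
        (u : ℂ) ^ (id t * Complex.I) =
      ((2 * Real.pi * (u ^ (b - 1) * Real.exp (-((1 + z) * u))) : ℝ) : ℂ) := by
    intro u (hu : 0 < u)
    have h2 : ∀ t : ℝ, Complex.Gamma (-(c + t * Complex.I)) *
        (z : ℂ) ^ ((c : ℂ) + t * Complex.I) * (u : ℂ) ^ (id t * Complex.I) =
        ((u ^ (-c) : ℝ) : ℂ) * (Complex.Gamma (-(c + t * Complex.I)) *
          ((z * u : ℝ) : ℂ) ^ ((c : ℂ) + t * Complex.I)) := by
      intro t
      rw [Complex.ofReal_mul, Complex.mul_cpow_ofReal_nonneg hz.le hu.le, cpow_add_mul_I hu,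
        Real.rpow_neg hu.le]
      have : ((u ^ c : ℝ) : ℂ) ≠ 0 := by exact_mod_cast (Real.rpow_pos_of_pos hu c).ne'
      push_cast at this ⊢
      simp only [id]
      field_simp
    simp only [h2]
    rw [integral_const_mul, integral_Gamma_neg_mul_cpow hc (mul_pos hz hu)]
    norm_cast
    have e1 : u ^ (b - 1) = u ^ (b + c - 1) * u ^ (-c) := by
      rw [← Real.rpow_add hu]; congr 1; ring
    have e2 : Real.exp (-((1 + z) * u)) = Real.exp (-u) * Real.exp (-(z * u)) := by
      rw [← Real.exp_add]; congr 1; ring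
    rw [e1, e2]; ring
  rw [setIntegral_congr_fun measurableSet_Ioi h1, integral_complex_ofReal, integral_const_mul,
    Real.integral_rpow_mul_exp_neg_mul_Ioi (by linarith) (by linarith), one_div,
    Real.inv_rpow (by linarith), ← Real.rpow_neg (by linarith)]
  congr 1
  ring

/-! ### The Fox H-functions of the closed form -/

theorem sopFoxParams_separates_iff (m n q : ℕ) (c : ℝ × ℝ) :
    (sopFoxParams m n q).Separates c ↔
      0 < 2 - (m : ℝ) + c.1 + c.2 ∧ c.1 < 0 ∧ 0 < (n : ℝ) - q + 1 + c.1 ∧ 0 < c.2 := by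
  simp only [BivariateFoxParams.Separates, sopFoxParams, List.take_succ_cons, List.take_zero,
    List.mem_singleton, forall_eq, List.not_mem_nil, false_imp_iff, implies_true, true_and,
    Complex.sub_re, Complex.natCast_re, Complex.one_re, Complex.zero_re, one_mul, sub_self,
    zero_add]
  constructor
  · rintro ⟨h1, h2, h3, h4⟩
    exact ⟨by linarith, by linarith, by linarith, by linarith⟩
  · rintro ⟨h1, h2, h3, h4⟩
    exact ⟨by linarith, by linarith, by linarith, by linarith⟩

/-- The integrand in the form needed for Fubini's theorem: a product of functions of one variable,
and the Gamma function that joins the variables. -/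
theorem sopFoxParams_onLines (m n q : ℕ) (x y : ℂ) (c p : ℝ × ℝ) :
    (sopFoxParams m n q).onLines x y c p =
      (Complex.Gamma (-(c.1 + p.1 * Complex.I)) * x ^ ((c.1 : ℂ) + p.1 * Complex.I) *
          Complex.Gamma (((n : ℝ) - q + 1 + c.1 : ℝ) + p.1 * Complex.I)) *
        (Complex.Gamma (c.2 + p.2 * Complex.I) * y ^ ((c.2 : ℂ) + p.2 * Complex.I)) *
        Complex.Gamma ((2 - (m : ℝ) + c.1 + c.2 : ℝ) + (p.1 + p.2 : ℝ) * Complex.I) := by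
  have e1 : 1 - ((m : ℂ) - 1) + (1 : ℝ) * (c.1 + p.1 * Complex.I) +
      (1 : ℝ) * (c.2 + p.2 * Complex.I) =
      (2 - (m : ℝ) + c.1 + c.2 : ℝ) + (p.1 + p.2 : ℝ) * Complex.I := by push_cast; ring
  have e2 : 1 - ((q : ℂ) - n) + (1 : ℝ) * (c.1 + p.1 * Complex.I) =
      ((n : ℝ) - q + 1 + c.1 : ℝ) + p.1 * Complex.I := by push_cast; ring
  have e3 : (0 : ℂ) - (1 : ℝ) * (c.1 + p.1 * Complex.I) = -(c.1 + p.1 * Complex.I) := by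
    push_cast; ring
  have e4 : (1 : ℂ) - 1 + (1 : ℝ) * (c.2 + p.2 * Complex.I) = c.2 + p.2 * Complex.I := by
    push_cast; ring
  simp only [BivariateFoxParams.onLines, BivariateFoxParams.integrand,
    BivariateFoxParams.jointKernel, FoxBlock.kernel, sopFoxParams, List.take_succ_cons,
    List.take_zero, List.drop_succ_cons, List.drop_nil, List.map_cons, List.map_nil,
    List.prod_cons, List.prod_nil, mul_one, div_one, one_mul, e1, e2, e3, e4]
  ring

/-- The real integral to which the bivariate Fox H-function of the closed form reduces, when each
of its Gamma functions is replaced by an Euler integral. -/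
theorem sopFoxParams_hasValue (m : ℕ) {n q : ℕ} (hq : q ≤ n) {x y : ℝ} (hx : 0 < x) (hy : 0 < y) :
    (sopFoxParams m n q).HasValue x y
      (Real.Gamma ((n : ℝ) - q + 1) * ∫ u in Set.Ioi (0 : ℝ), u ^ (1 - (m : ℝ)) * Real.exp (-u) *
        (1 + x * u) ^ (-((n : ℝ) - q + 1)) * Real.exp (-(y * u)⁻¹) : ℝ) := by
  refine ⟨⟨(-1 / 2, m + 1), ?_⟩, fun c hc => ?_⟩
  · have : (q : ℝ) ≤ n := by exact_mod_cast hq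
    rw [sopFoxParams_separates_iff]
    refine ⟨?_, ?_, ?_, ?_⟩ <;> simp only <;> first | positivity | linarith
  obtain ⟨h0, h1, h2, h3⟩ := (sopFoxParams_separates_iff m n q c).1 hc
  have hI1 := integrable_mul_Gamma h2 (integrable_Gamma_neg_mul_cpow h1 hx) measurable_id
  have hI2 := integrable_Gamma_mul_cpow h3 hy
  have hI := hI1.mul_prod hI2
  have hφ : Measurable fun p : ℝ × ℝ => p.1 + p.2 := by fun_prop
  simp only [funext (sopFoxParams_onLines m n q x y c)]
  refine ⟨integrable_mul_Gamma h0 hI hφ, ?_⟩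
  have key : ∀ u ∈ Set.Ioi (0 : ℝ),
      ((u ^ (2 - (m : ℝ) + c.1 + c.2 - 1) * Real.exp (-u) : ℝ) : ℂ) *
        ∫ p : ℝ × ℝ, (Complex.Gamma (-(c.1 + p.1 * Complex.I)) *
          (x : ℂ) ^ ((c.1 : ℂ) + p.1 * Complex.I) *
          Complex.Gamma (((n : ℝ) - q + 1 + c.1 : ℝ) + p.1 * Complex.I)) *
        (Complex.Gamma (c.2 + p.2 * Complex.I) * (y : ℂ) ^ ((c.2 : ℂ) + p.2 * Complex.I)) *
          (u : ℂ) ^ ((p.1 + p.2 : ℝ) * Complex.I) =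
      (((2 * Real.pi) ^ 2 * Real.Gamma ((n : ℝ) - q + 1) * (u ^ (1 - (m : ℝ)) * Real.exp (-u) *
        (1 + x * u) ^ (-((n : ℝ) - q + 1)) * Real.exp (-(y * u)⁻¹)) : ℝ) : ℂ) := by
    intro u (hu : 0 < u)
    have hsplit : ∀ p : ℝ × ℝ, (Complex.Gamma (-(c.1 + p.1 * Complex.I)) *
          (x : ℂ) ^ ((c.1 : ℂ) + p.1 * Complex.I) *
          Complex.Gamma (((n : ℝ) - q + 1 + c.1 : ℝ) + p.1 * Complex.I)) *
        (Complex.Gamma (c.2 + p.2 * Complex.I) * (y : ℂ) ^ ((c.2 : ℂ) + p.2 * Complex.I)) *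
          (u : ℂ) ^ ((p.1 + p.2 : ℝ) * Complex.I) =
        ((u ^ (-c.1 - c.2) : ℝ) : ℂ) * ((Complex.Gamma (-(c.1 + p.1 * Complex.I)) *
          ((x * u : ℝ) : ℂ) ^ ((c.1 : ℂ) + p.1 * Complex.I) *
          Complex.Gamma (((n : ℝ) - q + 1 + c.1 : ℝ) + p.1 * Complex.I)) *
        (Complex.Gamma (c.2 + p.2 * Complex.I) *
          ((y * u : ℝ) : ℂ) ^ ((c.2 : ℂ) + p.2 * Complex.I))) := by
      intro p
      have e : ((u ^ (-c.1 - c.2) : ℝ) : ℂ) * ((u ^ c.1 : ℝ) : ℂ) * ((u ^ c.2 : ℝ) : ℂ) = 1 := by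
        norm_cast
        rw [← Real.rpow_add hu, ← Real.rpow_add hu]
        ring_nf
        exact Real.rpow_zero u
      rw [Complex.ofReal_mul x, Complex.ofReal_mul y,
        Complex.mul_cpow_ofReal_nonneg hx.le hu.le, Complex.mul_cpow_ofReal_nonneg hy.le hu.le,
        cpow_add_mul_I hu, cpow_add_mul_I hu, Complex.ofReal_add p.1, add_mul (p.1 : ℂ),
        Complex.cpow_add (p.1 * Complex.I) _ (by exact_mod_cast hu.ne')]
      linear_combination (-(Complex.Gamma (-(c.1 + p.1 * Complex.I)) *
          (x : ℂ) ^ ((c.1 : ℂ) + p.1 * Complex.I) *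
          Complex.Gamma (((n : ℝ) - q + 1 + c.1 : ℝ) + p.1 * Complex.I)) *
        (Complex.Gamma (c.2 + p.2 * Complex.I) * (y : ℂ) ^ ((c.2 : ℂ) + p.2 * Complex.I)) *
          (u : ℂ) ^ (p.1 * Complex.I) * (u : ℂ) ^ (p.2 * Complex.I)) * e
    simp only [hsplit]
    rw [integral_const_mul]
    have hprod := integral_prod_mul (μ := (volume : Measure ℝ)) (ν := (volume : Measure ℝ))
      (fun s : ℝ => Complex.Gamma (-(c.1 + s * Complex.I)) *
          ((x * u : ℝ) : ℂ) ^ ((c.1 : ℂ) + s * Complex.I) *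
          Complex.Gamma (((n : ℝ) - q + 1 + c.1 : ℝ) + s * Complex.I))
      (fun t : ℝ => Complex.Gamma (c.2 + t * Complex.I) *
          ((y * u : ℝ) : ℂ) ^ ((c.2 : ℂ) + t * Complex.I))
    rw [← Measure.volume_eq_prod] at hprod
    rw [hprod, integral_Gamma_mul_Gamma_neg h1 h2 (mul_pos hx hu),
      integral_Gamma_mul_cpow h3 (mul_pos hy hu)]
    simp only [← Complex.ofReal_mul]
    have e : u ^ (1 - (m : ℝ)) = u ^ (2 - (m : ℝ) + c.1 + c.2 - 1) * u ^ (-c.1 - c.2) := by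
      rw [← Real.rpow_add hu]; congr 1; ring
    rw [e]
    congr 1
    ring
  have hF := integral_mul_Gamma h0 hI hφ
  rw [← Measure.volume_eq_prod] at hF
  have hF' := hF.trans (setIntegral_congr_fun measurableSet_Ioi key)
  rw [integral_complex_ofReal, integral_const_mul] at hF'
  refine (congrArg _ hF').trans ?_
  have hpi : 1 / (2 * (Real.pi : ℂ)) ^ 2 * ((2 * Real.pi) ^ 2 : ℝ) = 1 := by
    push_cast
    exact one_div_mul_cancel (by simp)
  rw [mul_assoc, Complex.ofReal_mul ((2 * Real.pi) ^ 2), ← mul_assoc, hpi, one_mul]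

theorem BivariateFoxParams.HasValue.foxH_eq {P : BivariateFoxParams} {x y v : ℂ}
    (h : P.HasValue x y v) : P.foxH x y = v := by
  have hex : ∃ v, P.HasValue x y v := ⟨v, h⟩
  have hs := hex.choose_spec
  obtain ⟨c, hc⟩ := h.1
  rw [BivariateFoxParams.foxH, dif_pos hex, ← (hs.2 c hc).2, (h.2 c hc).2]

/-! ### Gamma variables with integer shape -/

/-- `e^{-x} ∑_{i<n} x^i / i!`, the probability that a gamma variable with shape `n` and rate `1`
exceeds `x ≥ 0`. -/
noncomputable def erlangTail (n : ℕ) (x : ℝ) : ℝ :=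
  Real.exp (-x) * ∑ i ∈ Finset.range n, x ^ i / i.factorial

theorem erlangTail_nonneg (n : ℕ) {x : ℝ} (hx : 0 ≤ x) : 0 ≤ erlangTail n x := by
  unfold erlangTail; positivity

theorem continuous_erlangTail (n : ℕ) : Continuous (erlangTail n) := by
  unfold erlangTail; fun_prop

theorem hasDerivAt_erlangTail (n : ℕ) (x : ℝ) :
    HasDerivAt (erlangTail (n + 1)) (-(Real.exp (-x) * (x ^ n / n.factorial))) x := by
  induction n with
  | zero =>
    have h : erlangTail (0 + 1) = fun y => Real.exp (-y) := by
      ext y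
      simp [erlangTail]
    rw [h]
    simpa using (hasDerivAt_neg x).exp
  | succ n ih =>
    have h1 : erlangTail (n + 1 + 1) =
        fun y => erlangTail (n + 1) y + Real.exp (-y) * (y ^ (n + 1) / (n + 1).factorial) := by
      ext y
      simp only [erlangTail, Finset.sum_range_succ _ (n + 1), mul_add]
    rw [h1]
    have h2 := (hasDerivAt_neg x).exp.mul ((hasDerivAt_pow (n + 1) x).div_const (n + 1).factorial)
    refine (ih.add h2).congr_deriv ?_
    rw [Nat.factorial_succ]
    push_cast
    have : ((n : ℝ) + 1) ≠ 0 := by positivity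
    have : (n.factorial : ℝ) ≠ 0 := by positivity
    field_simp
    simp

theorem tendsto_erlangTail (n : ℕ) : Filter.Tendsto (erlangTail n) Filter.atTop (nhds 0) := by
  have h : erlangTail n = fun x =>
      ∑ i ∈ Finset.range n, x ^ i * Real.exp (-x) * (i.factorial : ℝ)⁻¹ := by
    ext x
    rw [erlangTail, Finset.mul_sum]
    exact Finset.sum_congr rfl fun i _ => by ring
  rw [h]
  have h2 := tendsto_finsetSum (Finset.range n) fun i _ =>
    (Real.tendsto_pow_mul_exp_neg_atTop_nhds_zero i).mul_const (i.factorial : ℝ)⁻¹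
  simpa using h2

theorem upperGamma_natCast {n : ℕ} (hn : 0 < n) {x : ℝ} (hx : 0 ≤ x) :
    upperGamma n x = (n - 1).factorial * erlangTail n x := by
  obtain ⟨n, rfl⟩ := Nat.exists_eq_add_of_lt hn
  simp only [zero_add, Nat.add_sub_cancel]
  have hF : (n.factorial : ℝ) ≠ 0 := by positivity
  have hd : ∀ y ∈ Set.Ici x, HasDerivAt (fun y => -(n.factorial * erlangTail (n + 1) y))
      (y ^ n * Real.exp (-y)) y := fun y _ => by
    refine ((hasDerivAt_erlangTail n y).const_mul (n.factorial : ℝ)).neg.congr_deriv ?_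
    field_simp
  have h := integral_Ioi_of_hasDerivAt_of_nonneg' hd
    (fun y hy => mul_nonneg (pow_nonneg (hx.trans hy.out.le) _) (Real.exp_pos _).le)
    (by simpa using ((tendsto_erlangTail (n + 1)).const_mul (n.factorial : ℝ)).neg)
  unfold upperGamma
  simp only [Nat.cast_add, Nat.cast_one, add_sub_cancel_right, Real.rpow_natCast]
  rw [h]
  ring

theorem lintegral_expMeasure {r : ℝ} {f : ℝ → ENNReal} (hf : Measurable f) :
    ∫⁻ x, f x ∂expMeasure r =
      ∫⁻ x in Set.Ioi 0, ENNReal.ofReal (r * Real.exp (-(r * x))) * f x := by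
  have hm : Measurable (gammaPDF 1 r) := (measurable_gammaPDFReal 1 r).ennreal_ofReal
  rw [expMeasure, gammaMeasure, lintegral_withDensity_eq_lintegral_mul _ hm hf,
    ← setLIntegral_congr Ioi_ae_eq_Ici.symm, ← lintegral_indicator measurableSet_Ici]
  refine lintegral_congr fun x => ?_
  by_cases hx : 0 ≤ x
  · rw [Set.indicator_of_mem (Set.mem_Ici.2 hx), Pi.mul_apply]
    exact congrArg (· * f x) (exponentialPDF_of_nonneg hx)
  · rw [Set.indicator_of_notMem (by simpa using hx), Pi.mul_apply, gammaPDF_of_neg (not_le.1 hx),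
      zero_mul]

instance nullSingletonClass_expMeasure (r : ℝ) : NullSingletonClass (expMeasure r) := by
  unfold expMeasure gammaMeasure; infer_instance

section Independence

variable {W : Type*} [MeasurableSpace W] {μ : Measure W} [IsProbabilityMeasure μ]
  {E F : Type*} [MeasurableSpace E] [MeasurableSpace F]

/-- Conditioning on one of two independent variables. -/
theorem ProbabilityTheory.IndepFun.measure_eq_lintegral {X : W → E} {Y : W → F} (hX : Measurable X)
    (hY : Measurable Y) (h : IndepFun X Y μ) {A : Set (E × F)} (hA : MeasurableSet A) :
    μ {w | (X w, Y w) ∈ A} = ∫⁻ x, μ {w | (x, Y w) ∈ A} ∂(μ.map X) := by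
  have h1 : μ {w | (X w, Y w) ∈ A} = μ.map (fun w => (X w, Y w)) A :=
    (Measure.map_apply (hX.prodMk hY) hA).symm
  have := Measure.isProbabilityMeasure_map (μ := μ) hY.aemeasurable
  rw [h1, h.map_prod_eq_prod_map_map hX.aemeasurable hY.aemeasurable, Measure.prod_apply hA]
  refine lintegral_congr fun x => ?_
  rw [Measure.map_apply hY (measurable_prodMk_left hA)]
  rfl

/-- Adding an independent exponential variable raises the shape of a gamma distribution by one. -/
theorem measure_lt_add_of_exp {X Y : W → ℝ} {r : ℝ} {n : ℕ} (hr : 0 < r) (hX : Measurable X)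
    (hY : Measurable Y) (hXl : HasLaw X (expMeasure r) μ) (h : IndepFun X Y μ) (hY0 : ∀ w, 0 ≤ Y w)
    (hYt : ∀ z, 0 ≤ z → μ {w | z < Y w} = ENNReal.ofReal (erlangTail n (r * z))) {z : ℝ}
    (hz : 0 ≤ z) :
    μ {w | z < X w + Y w} = ENNReal.ofReal (erlangTail (n + 1) (r * z)) := by
  have hA : MeasurableSet {p : ℝ × ℝ | z < p.1 + p.2} :=
    measurableSet_lt measurable_const (by fun_prop)
  have h1 := h.measure_eq_lintegral hX hY hA
  simp only [Set.mem_ofPred_eq] at h1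
  have hmeas : Measurable fun x => μ {w | z < x + Y w} :=
    measurable_measure_prodMk_left (ν := μ) (s := {p : ℝ × W | z < p.1 + Y p.2})
      (measurableSet_lt measurable_const (by fun_prop))
  rw [h1, hXl.map_eq, lintegral_expMeasure hmeas, ← Set.Ioc_union_Ioi_eq_Ioi hz,
    lintegral_union measurableSet_Ioi (Set.disjoint_left.2 fun x hx hx' => hx.2.not_gt hx')]
  have hI2 : ∫⁻ x in Set.Ioi z, ENNReal.ofReal (r * Real.exp (-(r * x))) * μ {w | z < x + Y w} =
      ENNReal.ofReal (Real.exp (-(r * z))) := by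
    have e : ∀ x ∈ Set.Ioi z, ENNReal.ofReal (r * Real.exp (-(r * x))) * μ {w | z < x + Y w} =
        ENNReal.ofReal (r * Real.exp (-(r * x))) := by
      intro x (hx : z < x)
      have : {w | z < x + Y w} = Set.univ :=
        Set.eq_univ_of_forall fun w => lt_add_of_lt_of_nonneg hx (hY0 w)
      rw [this, measure_univ, mul_one]
    have hint : IntegrableOn (fun x => r * Real.exp (-(r * x))) (Set.Ioi z) := by
      simpa only [IntegrableOn, neg_mul] using (exp_neg_integrableOn_Ioi z hr).const_mul r
    rw [setLIntegral_congr_fun measurableSet_Ioi e, ← ofReal_integral_eq_lintegral_ofReal hint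
      (Filter.Eventually.of_forall fun x => by positivity)]
    congr 1
    have h2 := integral_exp_mul_Ioi (neg_neg_of_pos hr) z
    simp only [neg_mul] at h2
    rw [integral_const_mul, h2]
    field_simp
  have hI1 : ∫⁻ x in Set.Ioc 0 z, ENNReal.ofReal (r * Real.exp (-(r * x))) * μ {w | z < x + Y w} =
      ENNReal.ofReal (Real.exp (-(r * z)) *
        ∑ i ∈ Finset.range n, (r * z) ^ (i + 1) / (i + 1).factorial) := by
    have e : ∀ x ∈ Set.Ioc 0 z, ENNReal.ofReal (r * Real.exp (-(r * x))) * μ {w | z < x + Y w} =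
        ENNReal.ofReal (r * Real.exp (-(r * z)) *
          ∑ i ∈ Finset.range n, (r * (z - x)) ^ i / i.factorial) := by
      intro x hx
      have h2 := hYt (z - x) (sub_nonneg.2 hx.2)
      simp only [sub_lt_iff_lt_add'] at h2
      rw [h2, ← ENNReal.ofReal_mul (by positivity), erlangTail]
      congr 1
      have h3 : Real.exp (-(r * z)) = Real.exp (-(r * x)) * Real.exp (-(r * (z - x))) := by
        rw [← Real.exp_add]; congr 1; ring
      rw [h3]; ring
    have hcont : Continuous fun x => r * Real.exp (-(r * z)) *
          ∑ i ∈ Finset.range n, (r * (z - x)) ^ i / i.factorial := by fun_prop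
    rw [setLIntegral_congr_fun measurableSet_Ioc e, ← ofReal_integral_eq_lintegral_ofReal
      (hcont.integrableOn_Ioc) ?_]
    · congr 1
      rw [← intervalIntegral.integral_of_le hz]
      have hd : ∀ x ∈ Set.uIcc 0 z, HasDerivAt (fun x => -(Real.exp (-(r * z)) *
          ∑ i ∈ Finset.range n, (r * (z - x)) ^ (i + 1) / (i + 1).factorial))
          (r * Real.exp (-(r * z)) *
          ∑ i ∈ Finset.range n, (r * (z - x)) ^ i / i.factorial) x := by
        intro x _
        have h4 : HasDerivAt (fun x => r * (z - x)) (-r) x := by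
          simpa using ((hasDerivAt_id x).const_sub z).const_mul r
        have h5 := (HasDerivAt.fun_sum (u := Finset.range n) fun i _ =>
          (h4.pow (i + 1)).div_const ((i + 1).factorial : ℝ)).const_mul (Real.exp (-(r * z)))
        refine h5.neg.congr_deriv ?_
        rw [Finset.mul_sum, Finset.mul_sum, ← Finset.sum_neg_distrib]
        refine Finset.sum_congr rfl fun i _ => ?_
        rw [Nat.factorial_succ]
        push_cast
        have : ((i : ℝ) + 1) ≠ 0 := by positivity
        have : (i.factorial : ℝ) ≠ 0 := by positivity
        field_simp
      rw [intervalIntegral.integral_eq_sub_of_hasDerivAt hd (hcont.intervalIntegrable _ _)]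
      simp
    · filter_upwards [ae_restrict_mem measurableSet_Ioc] with x hx
      have : 0 ≤ r * (z - x) := mul_nonneg hr.le (sub_nonneg.2 hx.2)
      positivity
  rw [hI1, hI2, ← ENNReal.ofReal_add (by positivity) (by positivity), erlangTail,
    Finset.sum_range_succ']
  congr 1
  simp
  ring

/-- A sum of independent exponential variables with a common rate has a gamma distribution. -/
theorem measure_lt_sum_of_exp {ι : Type*} {X : ι → W → ℝ} {r : ℝ} (hr : 0 < r)
    (hX : ∀ i, Measurable (X i)) (hX0 : ∀ i w, 0 ≤ X i w)
    (hXl : ∀ i, HasLaw (X i) (expMeasure r) μ) (h : iIndepFun X μ) (s : Finset ι) {z : ℝ}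
    (hz : 0 ≤ z) :
    μ {w | z < ∑ i ∈ s, X i w} = ENNReal.ofReal (erlangTail s.card (r * z)) := by
  classical
  induction s using Finset.induction_on generalizing z with
  | empty => simp [erlangTail, hz.not_gt]
  | insert i s hi ih =>
    simp only [Finset.sum_insert hi, Finset.card_insert_of_notMem hi]
    have h1 := h.indepFun_finsetSum_of_notMem hX hi
    have h2 : (∑ j ∈ s, X j) = fun w => ∑ j ∈ s, X j w := by ext w; simp
    rw [h2] at h1
    exact measure_lt_add_of_exp hr (hX i) (by fun_prop) (hXl i) h1.symm
      (fun w => Finset.sum_nonneg fun j _ => hX0 j w) (fun z hz => ih hz) hz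

end Independence

/-! ### Integrals of gamma tails against exponential variables -/

theorem integrableOn_pow_mul_exp (p : ℕ) {a : ℝ} (ha : 0 < a) :
    IntegrableOn (fun w : ℝ => w ^ p * Real.exp (-(a * w))) (Set.Ioi 0) ∧
      ∫ w in Set.Ioi (0 : ℝ), w ^ p * Real.exp (-(a * w)) = p.factorial / a ^ (p + 1) := by
  have h := Real.integral_rpow_mul_exp_neg_mul_Ioi (a := (p : ℝ) + 1) (by positivity) ha
  simp only [add_sub_cancel_right, Real.rpow_natCast, Real.Gamma_nat_eq_factorial] at h
  have h2 : (1 / a) ^ ((p : ℝ) + 1) * p.factorial = p.factorial / a ^ (p + 1) := by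
    rw [← Nat.cast_succ, Real.rpow_natCast, one_div, inv_pow]; field_simp
  rw [h2] at h
  refine ⟨?_, h⟩
  by_contra hn
  rw [integral_undef hn] at h
  have : 0 < (p.factorial : ℝ) / a ^ (p + 1) := by positivity
  linarith

theorem erlangTail_add (L : ℕ) (x y : ℝ) :
    erlangTail L (x + y) = Real.exp (-x) * Real.exp (-y) * ∑ n ∈ Finset.range L,
      ∑ q ∈ Finset.range (n + 1), x ^ q / q.factorial * (y ^ (n - q) / (n - q).factorial) := by
  rw [erlangTail, neg_add, Real.exp_add]
  congr 1
  refine Finset.sum_congr rfl fun n _ => ?_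
  rw [add_pow, Finset.sum_div]
  refine Finset.sum_congr rfl fun q hq => ?_
  have hq' : q ≤ n := Nat.lt_succ_iff.1 (Finset.mem_range.1 hq)
  rw [Nat.cast_choose ℝ hq']
  have : (n.factorial : ℝ) ≠ 0 := by positivity
  field_simp

section

variable {Ω Ω' β β₀ χ : ℝ}

/-- The expectation of a gamma tail at an affine function of an exponential variable, restricted to
the values that exceed `x`. -/
theorem lintegral_exp_mul_erlangTail (hΩ : 0 < Ω) (hβ : 0 < β) (hχ : 0 < χ) (L : ℕ) {x : ℝ}
    (hx : 0 < x) :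
    ∫⁻ y in Set.Ioi x, ENNReal.ofReal (Ω * Real.exp (-(Ω * y))) *
        ENNReal.ofReal (erlangTail L (χ + β * Ω * (y / x - 1))) =
      ENNReal.ofReal (∑ n ∈ Finset.range L, ∑ q ∈ Finset.range (n + 1),
        χ ^ q * Real.exp (-χ) / (q.factorial * β) *
          (x * Real.exp (-(Ω * x)) * ((1 + x / β) ^ (n - q + 1))⁻¹)) := by
  obtain ⟨a, ha_def⟩ : ∃ a, a = Ω * (1 + β / x) := ⟨_, rfl⟩
  have ha : 0 < a := by rw [ha_def]; positivity
  have hI := fun p => integrableOn_pow_mul_exp p ha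
  obtain ⟨f, hf⟩ : ∃ f : ℝ → ℝ, f = fun w => ∑ n ∈ Finset.range L, ∑ q ∈ Finset.range (n + 1),
    Ω * Real.exp (-(Ω * x)) * Real.exp (-χ) * (χ ^ q / q.factorial) *
      ((β * Ω / x) ^ (n - q) / (n - q).factorial) * (w ^ (n - q) * Real.exp (-(a * w))) :=
    ⟨_, rfl⟩
  have hfi : IntegrableOn f (Set.Ioi 0) := hf ▸
    integrable_finsetSum _ fun n _ => integrable_finsetSum _ fun q _ => (hI (n - q)).1.const_mul _
  have hf0 : 0 ≤ᵐ[volume.restrict (Set.Ioi 0)] f := by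
    filter_upwards [ae_restrict_mem measurableSet_Ioi] with w (hw : 0 < w)
    rw [hf, Pi.zero_apply]
    clear hfi hf ha_def
    exact Finset.sum_nonneg fun n _ => Finset.sum_nonneg fun q _ => by positivity
  have hfv : ∫ w in Set.Ioi 0, f w = ∑ n ∈ Finset.range L, ∑ q ∈ Finset.range (n + 1),
        χ ^ q * Real.exp (-χ) / (q.factorial * β) *
          (x * Real.exp (-(Ω * x)) * ((1 + x / β) ^ (n - q + 1))⁻¹) := by
    rw [hf]
    rw [integral_finsetSum _ fun n _ =>
      integrable_finsetSum _ fun q _ => (hI (n - q)).1.const_mul _]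
    refine Finset.sum_congr rfl fun n _ => ?_
    rw [integral_finsetSum _ fun q _ => (hI (n - q)).1.const_mul _]
    refine Finset.sum_congr rfl fun q _ => ?_
    rw [integral_const_mul, (hI (n - q)).2]
    have h1 : a = (β * Ω / x) * (1 + x / β) := by rw [ha_def]; field_simp; ring
    have h2 : 0 < 1 + x / β := by positivity
    have h3 : ((n - q).factorial : ℝ) ≠ 0 := by positivity
    rw [h1, mul_pow, pow_succ (β * Ω / x)]
    generalize 1 + x / β = d at h2
    field_simp
  rw [← hfv, ofReal_integral_eq_lintegral_ofReal hfi hf0]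
  -- the substitution `y = x + w`, which makes the argument of the tail `χ + (β Ω / x) w`
  have hmp := measurePreserving_add_left (volume : Measure ℝ) x
  have hpre : (fun w => x + w) ⁻¹' Set.Ioi x = Set.Ioi 0 := by ext w; simp
  rw [← hmp.setLIntegral_comp_preimage_emb (measurableEmbedding_addLeft x) _ (Set.Ioi x), hpre]
  refine setLIntegral_congr_fun measurableSet_Ioi fun w (hw : 0 < w) => ?_
  rw [← ENNReal.ofReal_mul (by positivity)]
  congr 1
  have h4 : β * Ω * ((x + w) / x - 1) = β * Ω / x * w := by field_simp; ring
  have h5 : Real.exp (-(Ω * (x + w))) * Real.exp (-(β * Ω / x * w)) =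
      Real.exp (-(Ω * x)) * Real.exp (-(a * w)) := by
    rw [← Real.exp_add, ← Real.exp_add]; congr 1; rw [ha_def]; field_simp; ring
  rw [h4, erlangTail_add]
  simp only [hf, mul_pow (β * Ω / x) w]
  calc _ = Ω * (Real.exp (-(Ω * (x + w))) * Real.exp (-(β * Ω / x * w))) * Real.exp (-χ) *
        ∑ n ∈ Finset.range L, ∑ q ∈ Finset.range (n + 1),
          χ ^ q / q.factorial * ((β * Ω / x) ^ (n - q) * w ^ (n - q) / (n - q).factorial) := by
        ring
    _ = _ := by
        rw [h5, Finset.mul_sum]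
        refine Finset.sum_congr rfl fun n _ => ?_
        rw [Finset.mul_sum]
        exact Finset.sum_congr rfl fun q _ => by ring

/-- The factor `e^{-β₀/x}` compensates the singularity of `x^{1-m}` at `0`. -/
theorem integrableOn_closedForm_term {s : ℝ} (hs : 0 < s) (hβ : 0 < β) (hβ₀ : 0 < β₀) (m p : ℕ) :
    IntegrableOn (fun x : ℝ => x ^ (1 - (m : ℝ)) * Real.exp (-(s * x)) *
      ((1 + x / β) ^ (p + 1))⁻¹ * Real.exp (-(β₀ / x))) (Set.Ioi 0) := by
  refine Integrable.mono' ((integrableOn_pow_mul_exp 1 hs).1.const_mul (m.factorial / β₀ ^ m))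
    (by fun_prop) ?_
  filter_upwards [ae_restrict_mem measurableSet_Ioi] with x (hx : 0 < x)
  rw [Real.norm_of_nonneg (by positivity)]
  have h1 : (β₀ / x) ^ m / m.factorial * Real.exp (-(β₀ / x)) ≤ 1 := by
    rw [Real.exp_neg, ← div_eq_mul_inv]
    exact (div_le_one (Real.exp_pos _)).2 (Real.pow_div_factorial_le_exp _ (by positivity) m)
  have h2 : ((1 + x / β) ^ (p + 1))⁻¹ ≤ 1 :=
    inv_le_one_of_one_le₀ (one_le_pow₀ (by have : 0 < x / β := by positivity
                                           linarith))
  have h3 : x ^ (1 - (m : ℝ)) = x * (x ^ m)⁻¹ := by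
    rw [Real.rpow_sub hx, Real.rpow_one, Real.rpow_natCast, div_eq_mul_inv]
  have h4 : x ^ (1 - (m : ℝ)) * Real.exp (-(s * x)) * ((1 + x / β) ^ (p + 1))⁻¹ *
      Real.exp (-(β₀ / x)) = (m.factorial / β₀ ^ m * (x ^ 1 * Real.exp (-(s * x)))) *
      ((β₀ / x) ^ m / m.factorial * Real.exp (-(β₀ / x))) * ((1 + x / β) ^ (p + 1))⁻¹ := by
    rw [h3, div_pow]
    have : (m.factorial : ℝ) ≠ 0 := by positivity
    have h5 : 0 < 1 + x / β := by positivity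
    generalize 1 + x / β = d at h5
    field_simp
  rw [h4]
  refine mul_le_of_le_one_right (by positivity) h2 |>.trans ?_
  exact mul_le_of_le_one_right (by positivity) h1

/-- The substitution `u = s x` that brings the terms into the form of the Fox H-function. -/
theorem integral_closedForm_term {s : ℝ} (hs : 0 < s) (hβ : 0 < β) (hβ₀ : 0 < β₀) (m p : ℕ) :
    ∫ x in Set.Ioi (0 : ℝ), x ^ (1 - (m : ℝ)) * Real.exp (-(s * x)) *
      ((1 + x / β) ^ (p + 1))⁻¹ * Real.exp (-(β₀ / x)) =
    s ^ ((m : ℤ) - 2) * ∫ u in Set.Ioi (0 : ℝ), u ^ (1 - (m : ℝ)) * Real.exp (-u) *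
      (1 + 1 / (β * s) * u) ^ (-((p : ℝ) + 1)) * Real.exp (-(1 / (β₀ * s) * u)⁻¹) := by
  have h := integral_comp_mul_left_Ioi (fun u : ℝ => u ^ (1 - (m : ℝ)) * Real.exp (-u) *
      (1 + 1 / (β * s) * u) ^ (-((p : ℝ) + 1)) * Real.exp (-(1 / (β₀ * s) * u)⁻¹)) 0 hs
  rw [mul_zero, smul_eq_mul] at h
  have h2 : s ^ ((m : ℤ) - 2) = s ^ ((m : ℤ) - 1) * s⁻¹ := by
    rw [← zpow_sub_one₀ hs.ne']; congr 1; ring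
  rw [h2, mul_assoc, ← h, ← integral_const_mul]
  refine setIntegral_congr_fun measurableSet_Ioi fun x (hx : 0 < x) => ?_
  have e1 : 1 / (β * s) * (s * x) = x / β := by field_simp
  have e2 : (1 / (β₀ * s) * (s * x))⁻¹ = β₀ / x := by field_simp
  have e3 : s ^ ((m : ℤ) - 1) * (s * x) ^ (1 - (m : ℝ)) = x ^ (1 - (m : ℝ)) := by
    rw [Real.mul_rpow hs.le hx.le, ← mul_assoc, ← Real.rpow_intCast, ← Real.rpow_add hs]
    push_cast
    simp
  have e4 : (1 + x / β) ^ (-((p : ℝ) + 1)) = ((1 + x / β) ^ (p + 1))⁻¹ := by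
    rw [Real.rpow_neg (by positivity), ← Nat.cast_succ, Real.rpow_natCast]
  rw [e1, e2, e4, ← e3]
  ring

/-- The double integral over two ordered exponential variables: here `β₀ / x` and
`χ + β Ω (y / x - 1)` are the scaled thresholds of `|θ|²` and of the gain `τ_k`. The binomial theorem
and the finite sums for the tails turn it into a triple sum. -/
theorem lintegral_exp_mul_erlangTail_mul (hΩ : 0 < Ω) (hΩ' : 0 < Ω') (hβ : 0 < β) (hβ₀ : 0 < β₀)
    (hχ : 0 < χ) (L : ℕ) :
    ∫⁻ x in Set.Ioi (0 : ℝ), ENNReal.ofReal (Ω' * Real.exp (-(Ω' * x))) *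
      (ENNReal.ofReal (erlangTail L (β₀ / x)) *
        ∫⁻ y in Set.Ioi x, ENNReal.ofReal (Ω * Real.exp (-(Ω * y))) *
          ENNReal.ofReal (erlangTail L (χ + β * Ω * (y / x - 1)))) =
    ENNReal.ofReal (∑ m ∈ Finset.range L, ∑ n ∈ Finset.range L, ∑ q ∈ Finset.range (n + 1),
      Ω' * β₀ ^ m * χ ^ q * Real.exp (-χ) / (m.factorial * q.factorial * β) *
        (((Ω' + Ω) ^ ((m : ℤ) - 2)) * ∫ u in Set.Ioi (0 : ℝ), u ^ (1 - (m : ℝ)) * Real.exp (-u) *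
          (1 + 1 / (β * (Ω' + Ω)) * u) ^ (-((n : ℝ) - q + 1)) *
            Real.exp (-(1 / (β₀ * (Ω' + Ω)) * u)⁻¹))) := by
  have hs : 0 < Ω' + Ω := by positivity
  have hI := integrableOn_closedForm_term hs hβ hβ₀
  obtain ⟨f, hf⟩ : ∃ f : ℝ → ℝ, f = fun x =>
    ∑ m ∈ Finset.range L, ∑ n ∈ Finset.range L, ∑ q ∈ Finset.range (n + 1),
      Ω' * β₀ ^ m * χ ^ q * Real.exp (-χ) / (m.factorial * q.factorial * β) *
        (x ^ (1 - (m : ℝ)) * Real.exp (-((Ω' + Ω) * x)) * ((1 + x / β) ^ (n - q + 1))⁻¹ *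
          Real.exp (-(β₀ / x))) := ⟨_, rfl⟩
  have hfi : IntegrableOn f (Set.Ioi 0) := hf ▸
    integrable_finsetSum _ fun m _ => integrable_finsetSum _ fun n _ =>
      integrable_finsetSum _ fun q _ => (hI m (n - q)).const_mul _
  have hf0 : 0 ≤ᵐ[volume.restrict (Set.Ioi 0)] f := by
    filter_upwards [ae_restrict_mem measurableSet_Ioi] with x (hx : 0 < x)
    rw [hf, Pi.zero_apply]
    clear hfi hf
    exact Finset.sum_nonneg fun m _ => Finset.sum_nonneg fun n _ =>
      Finset.sum_nonneg fun q _ => by positivity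
  have hfv : ∫ x in Set.Ioi 0, f x = ∑ m ∈ Finset.range L, ∑ n ∈ Finset.range L,
      ∑ q ∈ Finset.range (n + 1),
      Ω' * β₀ ^ m * χ ^ q * Real.exp (-χ) / (m.factorial * q.factorial * β) *
        (((Ω' + Ω) ^ ((m : ℤ) - 2)) * ∫ u in Set.Ioi (0 : ℝ), u ^ (1 - (m : ℝ)) * Real.exp (-u) *
          (1 + 1 / (β * (Ω' + Ω)) * u) ^ (-((n : ℝ) - q + 1)) *
            Real.exp (-(1 / (β₀ * (Ω' + Ω)) * u)⁻¹)) := by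
    rw [hf]
    rw [integral_finsetSum _ fun m _ => integrable_finsetSum _ fun n _ =>
      integrable_finsetSum _ fun q _ => (hI m (n - q)).const_mul _]
    refine Finset.sum_congr rfl fun m _ => ?_
    rw [integral_finsetSum _ fun n _ =>
      integrable_finsetSum _ fun q _ => (hI m (n - q)).const_mul _]
    refine Finset.sum_congr rfl fun n _ => ?_
    rw [integral_finsetSum _ fun q _ => (hI m (n - q)).const_mul _]
    refine Finset.sum_congr rfl fun q hq => ?_
    have hq' : q ≤ n := Nat.lt_succ_iff.1 (Finset.mem_range.1 hq)
    rw [integral_const_mul, integral_closedForm_term hs hβ hβ₀, Nat.cast_sub hq']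
  rw [← hfv, ofReal_integral_eq_lintegral_ofReal hfi hf0]
  refine setLIntegral_congr_fun measurableSet_Ioi fun x (hx : 0 < x) => ?_
  rw [lintegral_exp_mul_erlangTail hΩ hβ hχ L hx,
    ← ENNReal.ofReal_mul (erlangTail_nonneg L (by positivity)), ← ENNReal.ofReal_mul (by positivity)]
  congr 1
  simp only [hf, erlangTail]
  rw [mul_assoc (Real.exp (-(β₀ / x))), Finset.sum_mul]
  simp only [Finset.mul_sum]
  refine Finset.sum_congr rfl fun m _ => Finset.sum_congr rfl fun n _ =>
    Finset.sum_congr rfl fun q _ => ?_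
  have h3 : x ^ (1 - (m : ℝ)) = x * (x ^ m)⁻¹ := by
    rw [Real.rpow_sub hx, Real.rpow_one, Real.rpow_natCast, div_eq_mul_inv]
  have h4 : Real.exp (-((Ω' + Ω) * x)) = Real.exp (-(Ω' * x)) * Real.exp (-(Ω * x)) := by
    rw [← Real.exp_add]; congr 1; ring
  rw [h3, h4, div_pow]
  have h5 : 0 < 1 + x / β := by positivity
  generalize 1 + x / β = d at h5
  field_simp

end

/-! ### Integrating out independent variables -/

section

variable {W : Type*} [MeasurableSpace W] {μ : Measure W} [IsProbabilityMeasure μ]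
  {E : Type*} [MeasurableSpace E]

/-- A constraint on a variable that is independent of the others integrates out to its tail
function. -/
theorem ProbabilityTheory.IndepFun.lintegral_mul_ite_lt {Y : W → ℝ} {V : W → E} (h : IndepFun Y V μ)
    (hY : Measurable Y) (hV : Measurable V) {S : ℝ → ENNReal} (hS : Measurable S)
    (hYt : ∀ z, 0 ≤ z → μ {w | z < Y w} = S z) {f : E → ENNReal} (hf : Measurable f) {t : E → ℝ}
    (ht : Measurable t) (hft : ∀ v, f v ≠ 0 → 0 ≤ t v) :
    ∫⁻ w, f (V w) * (if t (V w) < Y w then 1 else 0) ∂μ = ∫⁻ w, f (V w) * S (t (V w)) ∂μ := by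
  have := Measure.isProbabilityMeasure_map (μ := μ) hY.aemeasurable
  have hm : Measurable fun p : E × ℝ => f p.1 * (if t p.1 < p.2 then (1 : ENNReal) else 0) :=
    (hf.comp measurable_fst).mul (Measurable.ite
      (measurableSet_lt (ht.comp measurable_fst) measurable_snd) measurable_const measurable_const)
  have hm' : Measurable fun v => f v * S (t v) := hf.mul (hS.comp ht)
  rw [← lintegral_map (f := fun p : E × ℝ => f p.1 * (if t p.1 < p.2 then (1 : ENNReal) else 0))
      hm (hV.prodMk hY),
    h.symm.map_prod_eq_prod_map_map hV.aemeasurable hY.aemeasurable, lintegral_prod _ hm.aemeasurable,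
    ← lintegral_map (f := fun v => f v * S (t v)) hm' hV]
  refine lintegral_congr fun v => ?_
  by_cases hv : f v = 0
  · simp [hv]
  dsimp only
  rw [← hYt _ (hft v hv), lintegral_const_mul _ (Measurable.ite
    (measurableSet_lt measurable_const measurable_id') measurable_const measurable_const)]
  congr 1
  have h1 : (fun y : ℝ => if t v < y then (1 : ENNReal) else 0) = (Set.Ioi (t v)).indicator 1 := by
    ext y; simp [Set.indicator_apply]
  rw [h1, lintegral_indicator_one measurableSet_Ioi, Measure.map_apply hY measurableSet_Ioi]
  rfl

/-- The probability that two independent exponential variables, in increasing order, and three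
further independent gamma variables satisfy the decoding constraints. -/
theorem measure_ordered_constraints {X₁ X₂ T₀ T₁ T₂ : W → ℝ} (hX₁ : Measurable X₁)
    (hX₂ : Measurable X₂) (hT₀ : Measurable T₀) (hT₁ : Measurable T₁) (hT₂ : Measurable T₂)
    {Ω₁ Ω₂ : ℝ} (hX₁l : HasLaw X₁ (expMeasure Ω₁) μ) (hX₂l : HasLaw X₂ (expMeasure Ω₂) μ)
    {S₀ S₁ S₂ : ℝ → ENNReal} (hS₀ : Measurable S₀) (hS₁ : Measurable S₁) (hS₂ : Measurable S₂)
    (hT₀t : ∀ z, 0 ≤ z → μ {w | z < T₀ w} = S₀ z) (hT₁t : ∀ z, 0 ≤ z → μ {w | z < T₁ w} = S₁ z)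
    (hT₂t : ∀ z, 0 ≤ z → μ {w | z < T₂ w} = S₂ z)
    (h₀ : IndepFun T₀ (fun w => (T₁ w, T₂ w, X₁ w, X₂ w)) μ)
    (h₁ : IndepFun T₁ (fun w => (T₂ w, X₁ w, X₂ w)) μ)
    (h₂ : IndepFun T₂ (fun w => (X₁ w, X₂ w)) μ) (hX : IndepFun X₁ X₂ μ)
    {a c : ℝ} (ha : 0 ≤ a) (hc : 0 ≤ c) {t : ℝ → ℝ → ℝ} (ht : Measurable (Function.uncurry t))
    (ht0 : ∀ x y, 0 < x → x < y → 0 ≤ t x y) :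
    μ {w | (0 < X₁ w ∧ X₁ w < X₂ w) ∧ t (X₁ w) (X₂ w) < T₂ w ∧ c < T₁ w ∧ a / X₁ w < T₀ w} =
      (∫⁻ x in Set.Ioi 0, ENNReal.ofReal (Ω₁ * Real.exp (-(Ω₁ * x))) * (S₀ (a / x) *
        ∫⁻ y in Set.Ioi x, ENNReal.ofReal (Ω₂ * Real.exp (-(Ω₂ * y))) * S₂ (t x y))) * S₁ c := by
  classical
  obtain ⟨f, hf⟩ : ∃ f : ℝ × ℝ → ENNReal,
    f = fun p => if 0 < p.1 ∧ p.1 < p.2 then 1 else 0 := ⟨_, rfl⟩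
  have hfm : Measurable f := by
    rw [hf]
    exact Measurable.ite ((measurableSet_lt measurable_const measurable_fst).inter
      (measurableSet_lt measurable_fst measurable_snd)) measurable_const measurable_const
  have hf0 : ∀ p, f p ≠ 0 → 0 < p.1 ∧ p.1 < p.2 := by
    intro p hp
    by_contra hn
    rw [hf] at hp
    exact hp (if_neg hn)
  have htm : Measurable fun p : ℝ × ℝ => t p.1 p.2 := ht
  -- the indicators of the constraints
  have hi₂ : Measurable fun v : ℝ × ℝ × ℝ => if t v.2.1 v.2.2 < v.1 then (1 : ENNReal) else 0 :=
    Measurable.ite (measurableSet_lt (htm.comp measurable_snd) measurable_fst) measurable_const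
      measurable_const
  have hi₁ : Measurable fun v : ℝ × ℝ × ℝ × ℝ => if c < v.1 then (1 : ENNReal) else 0 :=
    Measurable.ite (measurableSet_lt measurable_const measurable_fst) measurable_const
      measurable_const
  have e0 : μ {w | (0 < X₁ w ∧ X₁ w < X₂ w) ∧ t (X₁ w) (X₂ w) < T₂ w ∧ c < T₁ w ∧
        a / X₁ w < T₀ w} =
      ∫⁻ w, f (X₁ w, X₂ w) * (if t (X₁ w) (X₂ w) < T₂ w then 1 else 0) *
        (if c < T₁ w then 1 else 0) * (if a / X₁ w < T₀ w then 1 else 0) ∂μ := by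
    rw [← lintegral_indicator_one]
    · refine lintegral_congr fun w => ?_
      simp only [Set.indicator_apply, Set.mem_ofPred_eq, hf, Pi.one_apply]
      by_cases h1 : 0 < X₁ w ∧ X₁ w < X₂ w <;> by_cases h2 : t (X₁ w) (X₂ w) < T₂ w <;>
        by_cases h3 : c < T₁ w <;> by_cases h4 : a / X₁ w < T₀ w <;> simp [h1, h2, h3, h4]
    · have hm : Measurable fun w => t (X₁ w) (X₂ w) := htm.comp (hX₁.prodMk hX₂)
      exact (((measurableSet_lt measurable_const hX₁).inter (measurableSet_lt hX₁ hX₂))).inter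
        ((measurableSet_lt hm hT₂).inter ((measurableSet_lt measurable_const hT₁).inter
          (measurableSet_lt (by fun_prop) hT₀)))
  have e1 := h₀.lintegral_mul_ite_lt hT₀ (by fun_prop) hS₀ hT₀t
    (f := fun v => f (v.2.2.1, v.2.2.2) * (if t v.2.2.1 v.2.2.2 < v.2.1 then 1 else 0) *
        (if c < v.1 then 1 else 0)) (((hfm.comp (by fun_prop)).mul (hi₂.comp measurable_snd)).mul hi₁)
    (t := fun v => a / v.2.2.1) (by fun_prop) (fun v hv => by
      have := (hf0 _ (left_ne_zero_of_mul (left_ne_zero_of_mul hv))).1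
      exact div_nonneg ha this.le)
  have e2 := h₁.lintegral_mul_ite_lt hT₁ (by fun_prop) hS₁ hT₁t
    (f := fun v => f (v.2.1, v.2.2) * (if t v.2.1 v.2.2 < v.1 then 1 else 0) * S₀ (a / v.2.1))
    (((hfm.comp (by fun_prop)).mul hi₂).mul (hS₀.comp (by fun_prop))) (t := fun _ => c)
    (by fun_prop) (fun _ _ => hc)
  have e3 := h₂.lintegral_mul_ite_lt hT₂ (by fun_prop) hS₂ hT₂t
    (f := fun v => f v * S₀ (a / v.1) * S₁ c)
    ((hfm.mul (hS₀.comp (by fun_prop))).mul measurable_const) (t := fun v => t v.1 v.2) htm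
    (fun v hv => by
      have := hf0 _ (left_ne_zero_of_mul (left_ne_zero_of_mul hv))
      exact ht0 _ _ this.1 this.2)
  have hm4 : Measurable fun p : ℝ × ℝ => f p * S₀ (a / p.1) * S₁ c * S₂ (t p.1 p.2) :=
    ((hfm.mul (hS₀.comp (by fun_prop))).mul measurable_const).mul (hS₂.comp htm)
  have hinst : IsProbabilityMeasure (μ.map X₂) :=
    Measure.isProbabilityMeasure_map hX₂.aemeasurable
  rw [e0, e1]
  calc _ = ∫⁻ w, f (X₁ w, X₂ w) * (if t (X₁ w) (X₂ w) < T₂ w then 1 else 0) * S₀ (a / X₁ w) *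
        (if c < T₁ w then 1 else 0) ∂μ := lintegral_congr fun w => by dsimp only; ring
    _ = ∫⁻ w, f (X₁ w, X₂ w) * S₀ (a / X₁ w) * S₁ c *
        (if t (X₁ w) (X₂ w) < T₂ w then 1 else 0) ∂μ := by
        rw [e2]
        exact lintegral_congr fun w => by dsimp only; ring
    _ = ∫⁻ p, f p * S₀ (a / p.1) * S₁ c * S₂ (t p.1 p.2)
          ∂((expMeasure Ω₁).prod (expMeasure Ω₂)) := by
        rw [e3, ← hX₁l.map_eq, ← hX₂l.map_eq,
          ← hX.map_prod_eq_prod_map_map hX₁.aemeasurable hX₂.aemeasurable,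
          lintegral_map hm4 (hX₁.prodMk hX₂)]
    _ = ∫⁻ x in Set.Ioi 0, ENNReal.ofReal (Ω₁ * Real.exp (-(Ω₁ * x))) *
          ∫⁻ y in Set.Ioi 0, ENNReal.ofReal (Ω₂ * Real.exp (-(Ω₂ * y))) *
            (f (x, y) * S₀ (a / x) * S₁ c * S₂ (t x y)) := by
        have : SFinite (expMeasure Ω₂) := by rw [← hX₂l.map_eq]; infer_instance
        rw [lintegral_prod _ hm4.aemeasurable, lintegral_expMeasure hm4.lintegral_prod_right']
        refine lintegral_congr fun x => ?_
        exact congrArg _ (lintegral_expMeasure (hm4.comp measurable_prodMk_left))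
    _ = ∫⁻ x in Set.Ioi 0, (ENNReal.ofReal (Ω₁ * Real.exp (-(Ω₁ * x))) * (S₀ (a / x) *
        ∫⁻ y in Set.Ioi x, ENNReal.ofReal (Ω₂ * Real.exp (-(Ω₂ * y))) * S₂ (t x y))) * S₁ c := by
        refine setLIntegral_congr_fun measurableSet_Ioi fun x (hx : 0 < x) => ?_
        have hmx : Measurable fun y => ENNReal.ofReal (Ω₂ * Real.exp (-(Ω₂ * y))) * S₂ (t x y) :=
          Measurable.mul (by fun_prop) (hS₂.comp (htm.comp measurable_prodMk_left))
        have h5 : ∫⁻ y in Set.Ioi 0, ENNReal.ofReal (Ω₂ * Real.exp (-(Ω₂ * y))) *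
            (f (x, y) * S₀ (a / x) * S₁ c * S₂ (t x y)) = S₀ (a / x) * S₁ c *
            ∫⁻ y in Set.Ioi x, ENNReal.ofReal (Ω₂ * Real.exp (-(Ω₂ * y))) * S₂ (t x y) := by
          rw [← lintegral_const_mul _ hmx, ← lintegral_indicator measurableSet_Ioi,
            ← lintegral_indicator measurableSet_Ioi]
          refine lintegral_congr fun y => ?_
          simp only [Set.indicator_apply, Set.mem_Ioi, hf, hx, true_and]
          by_cases hxy : x < y
          · simp only [hxy, hx.trans hxy, if_true]
            ring
          · simp [hxy]
        rw [h5]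
        ring
    _ = _ := by
        rw [lintegral_mul_const' _ _ (by rw [← hT₁t c hc]; exact measure_ne_top _ _)]

end

/-! ### Parameters of the system -/

namespace SymbioticRSMA

variable {S : SymbioticRSMA}

theorem Admissible.Ψ_pos (hS : S.Admissible) : 0 < S.Ψ := div_pos hS.p_pos hS.noise_pos

theorem Admissible.γc_pos (hS : S.Admissible) : 0 < S.γc :=
  sub_pos.2 (Real.one_lt_rpow one_lt_two hS.Rc_pos)

theorem Admissible.γp_pos (hS : S.Admissible) (k : Fin 2) : 0 < S.γp k :=
  sub_pos.2 (Real.one_lt_rpow one_lt_two (hS.R_pos k))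

theorem Admissible.γb_pos (hS : S.Admissible) : 0 < S.γb :=
  sub_pos.2 (Real.one_lt_rpow one_lt_two hS.Rb_pos)

theorem Admissible.ρc_pos (hS : S.Admissible) (k : Fin 2) : 0 < S.ρc k :=
  div_pos (sub_pos.2 (hS.common_decodable k)) hS.γc_pos

theorem Admissible.ρ_pos (hS : S.Admissible) (k : Fin 2) : 0 < S.ρ k :=
  div_pos (hS.α_pos k) (hS.γp_pos k)

theorem Admissible.piMax_pos (hS : S.Admissible) (k : Fin 2) : 0 < S.piMax k :=
  lt_max_of_lt_left (one_div_pos.2 (hS.ρ_pos k))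

theorem Admissible.β0_pos (hS : S.Admissible) : 0 < S.β0 :=
  div_pos (mul_pos hS.γb_pos hS.lam0_pos) (mul_pos hS.η_pos hS.Ψ_pos)

theorem Admissible.β_pos (hS : S.Admissible) (k : Fin 2) : 0 < S.β k :=
  div_pos (mul_pos (mul_pos (hS.lam_pos k) (hS.piMax_pos k)) hS.γb_pos)
    (mul_pos hS.Ψ_pos (hS.Om_pos k))

theorem Admissible.χ_pos (hS : S.Admissible) (k : Fin 2) : 0 < S.χ k :=
  div_pos (mul_pos (mul_pos (hS.β_pos k) (hS.Om_pos k)) (by linarith [hS.γb_pos])) hS.γb_pos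

theorem Admissible.βsum_pos (hS : S.Admissible) (j k : Fin 2) : 0 < S.βsum j k :=
  add_pos (hS.Om_pos j) (hS.Om_pos k)

/-! ### Decoding conditions as constraints on the channel gains -/

theorem Admissible.sicRule_iff (hS : S.Admissible) (k : Fin 2) {δ θ τ G : ℝ} (hδ : 0 < δ)
    (hτ : 0 ≤ τ) (hG : 0 ≤ G) :
    S.SICRule k δ θ τ G ↔ S.γb < δ * (S.η * S.Ψ * |θ| ^ 2 * G) ∧
      δ * (S.η * S.Ψ * |θ| ^ 2 * G) < S.ρc k * S.Ψ * τ - 1 ∧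
      δ * (S.η * S.Ψ * |θ| ^ 2 * G) < S.ρ k * S.Ψ * τ - 1 := by
  have hu : S.η * δ * S.Ψ * |θ| ^ 2 * G = δ * (S.η * S.Ψ * |θ| ^ 2 * G) := by ring
  have hη := hS.η_pos
  have hΨ := hS.Ψ_pos
  have hα := hS.α_pos k
  have hγc := hS.γc_pos
  have hγp := hS.γp_pos k
  rw [SICRule, sinrCommon, sinrPrivate, sinrBackscatter, ρc, ρ, hu]
  generalize hv : δ * (S.η * S.Ψ * |θ| ^ 2 * G) = v
  have hv0 : 0 ≤ v := by rw [← hv]; positivity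
  have h1 : S.γc < S.αc * S.Ψ * τ / (S.α k * S.Ψ * τ + v + 1) ↔
      v < (S.αc - S.γc * S.α k) / S.γc * S.Ψ * τ - 1 := by
    rw [lt_div_iff₀ (by positivity), lt_sub_iff_add_lt, div_mul_eq_mul_div, div_mul_eq_mul_div,
      lt_div_iff₀ hγc]
    constructor <;> intro h <;> linarith
  have h2 : S.γp k < S.α k * S.Ψ * τ / (v + 1) ↔ v < S.α k / S.γp k * S.Ψ * τ - 1 := by
    rw [lt_div_iff₀ (by positivity), lt_sub_iff_add_lt, div_mul_eq_mul_div, div_mul_eq_mul_div,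
      lt_div_iff₀ hγp, mul_comm]
  rw [h1, h2]
  tauto

theorem Admissible.exists_sicRule_iff (hS : S.Admissible) {θ : ℝ} {τ G : Fin 2 → ℝ}
    (hτ : ∀ k, 0 ≤ τ k) (hG : ∀ k, 0 ≤ G k) :
    (∃ δ ∈ Set.Ioc (0 : ℝ) 1, ∀ k, S.SICRule k δ θ (τ k) (G k)) ↔
      max (S.deltaLow θ (G 0)) (S.deltaLow θ (G 1)) <
        min 1 (min (S.deltaUp 0 θ (τ 0) (G 0)) (S.deltaUp 1 θ (τ 1) (G 1))) := by
  have hγb := hS.γb_pos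
  have hu0 : ∀ k, 0 ≤ S.η * S.Ψ * |θ| ^ 2 * G k := fun k => by
    have := hS.η_pos; have := hS.Ψ_pos; have := hG k; positivity
  by_cases hu : ∀ k, 0 < S.η * S.Ψ * |θ| ^ 2 * G k
  · have hkey : ∀ δ, 0 < δ → ∀ k, S.SICRule k δ θ (τ k) (G k) ↔
        S.deltaLow θ (G k) < δ ∧ δ < S.deltaUp k θ (τ k) (G k) := fun δ hδ k => by
      rw [hS.sicRule_iff k hδ (hτ k) (hG k), deltaLow, deltaUp, lt_min_iff, div_lt_iff₀ (hu k),
        lt_div_iff₀ (hu k), lt_div_iff₀ (hu k)]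
    constructor
    · rintro ⟨δ, hδ, h⟩
      have h0 := (hkey δ hδ.1 0).1 (h 0)
      have h1 := (hkey δ hδ.1 1).1 (h 1)
      have hlow := max_lt h0.1 h1.1
      exact lt_min (hlow.trans_le hδ.2) (hlow.trans (lt_min h0.2 h1.2))
    · intro h
      obtain ⟨δ, hl, hr⟩ := exists_between h
      have hδ : 0 < δ := (div_pos hγb (hu 0)).trans ((le_max_left _ _).trans_lt hl)
      refine ⟨δ, ⟨hδ, (hr.trans_le (min_le_left _ _)).le⟩, fun k => (hkey δ hδ k).2 ?_⟩
      have hr' := lt_min_iff.1 (hr.trans_le (min_le_right _ _))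
      have hl' := max_lt_iff.1 hl
      fin_cases k
      exacts [⟨hl'.1, hr'.1⟩, ⟨hl'.2, hr'.2⟩]
  · -- if `|θ|² |g_k|² = 0`, both sides fail: the right-hand side because `x / 0 = 0`
    obtain ⟨k, hk⟩ := not_forall.1 hu
    have hk0 : S.η * S.Ψ * |θ| ^ 2 * G k = 0 := le_antisymm (not_lt.1 hk) (hu0 k)
    refine iff_of_false ?_ ?_
    · rintro ⟨δ, hδ, h⟩
      have := ((hS.sicRule_iff k hδ.1 (hτ k) (hG k)).1 (h k)).1
      rw [hk0, mul_zero] at this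
      exact this.not_gt hγb
    · have hlow : S.deltaLow θ (G k) = 0 := by rw [deltaLow, hk0, div_zero]
      have hup : S.deltaUp k θ (τ k) (G k) = 0 := by
        rw [deltaUp, hk0, div_zero, div_zero, min_self]
      refine not_lt.2 (le_trans (b := (0 : ℝ)) ?_ ?_)
      · refine (min_le_right _ _).trans (le_trans ?_ hup.le)
        fin_cases k
        exacts [min_le_left _ _, min_le_right _ _]
      · refine hlow.ge.trans ?_
        fin_cases k
        exacts [le_max_left _ _, le_max_right _ _]

theorem Admissible.lt_deltaUp_iff (hS : S.Admissible) (k : Fin 2) {x θ τ G : ℝ} (hx : 0 ≤ x)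
    (hu : 0 < S.η * S.Ψ * |θ| ^ 2 * G) :
    x < S.deltaUp k θ τ G ↔ S.piMax k / S.Ψ * (1 + x * (S.η * S.Ψ * |θ| ^ 2 * G)) < τ := by
  have hρ := hS.ρ_pos k
  have hρc := hS.ρc_pos k
  have hΨ := hS.Ψ_pos
  rw [deltaUp, lt_min_iff, lt_div_iff₀ hu, lt_div_iff₀ hu, piMax]
  generalize hv : x * (S.η * S.Ψ * |θ| ^ 2 * G) = v
  have hv0 : 0 ≤ v := by rw [← hv]; positivity
  rw [div_mul_eq_mul_div, div_lt_iff₀ hΨ, max_mul_of_nonneg _ _ (by positivity), max_lt_iff,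
    one_div_mul_eq_div, one_div_mul_eq_div, div_lt_iff₀ hρ, div_lt_iff₀ hρc]
  constructor
  · rintro ⟨h1, h2⟩
    exact ⟨by linarith, by linarith⟩
  · rintro ⟨h1, h2⟩
    exact ⟨by linarith, by linarith⟩

/-- If user `j` has the weaker backscatter link, then it alone determines the lower end of the range
of reflection coefficients, and the constraints decouple. -/
theorem Admissible.range_nonempty_iff (hS : S.Admissible) {j k : Fin 2} (hjk : j ≠ k) {θ : ℝ}
    {τ G : Fin 2 → ℝ} (hG : ∀ k, 0 ≤ G k) (hlt : G j < G k) :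
    max (S.deltaLow θ (G 0)) (S.deltaLow θ (G 1)) <
        min 1 (min (S.deltaUp 0 θ (τ 0) (G 0)) (S.deltaUp 1 θ (τ 1) (G 1))) ↔
      0 < G j ∧ S.piMax k / S.Ψ * (1 + S.γb * (G k / G j)) < τ k ∧
        S.piMax j / S.Ψ * (S.γb + 1) < τ j ∧ S.γb / (S.η * S.Ψ) / G j < |θ| ^ 2 := by
  have hγb := hS.γb_pos
  have hΨ := hS.Ψ_pos
  have hηΨ : 0 < S.η * S.Ψ := mul_pos hS.η_pos hΨ
  have hsym : (max (S.deltaLow θ (G 0)) (S.deltaLow θ (G 1)) <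
        min 1 (min (S.deltaUp 0 θ (τ 0) (G 0)) (S.deltaUp 1 θ (τ 1) (G 1)))) ↔
      max (S.deltaLow θ (G j)) (S.deltaLow θ (G k)) <
        min 1 (min (S.deltaUp j θ (τ j) (G j)) (S.deltaUp k θ (τ k) (G k))) := by
    fin_cases j <;> fin_cases k
    · exact absurd rfl hjk
    · rfl
    · simp only [Fin.mk_one, Fin.zero_eta, max_comm (S.deltaLow θ (G 1)),
        min_comm (S.deltaUp 1 θ (τ 1) (G 1))]
    · exact absurd rfl hjk
  rw [hsym]
  by_cases hθ : 0 < |θ| ^ 2 ∧ 0 < G j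
  · obtain ⟨hθ, hGj⟩ := hθ
    have huj : 0 < S.η * S.Ψ * |θ| ^ 2 * G j := by positivity
    have hGk : 0 < G k := hGj.trans hlt
    have huk : 0 < S.η * S.Ψ * |θ| ^ 2 * G k := by positivity
    have hlow : S.deltaLow θ (G k) ≤ S.deltaLow θ (G j) := by
      unfold deltaLow
      gcongr
    have hx0 : 0 ≤ S.deltaLow θ (G j) := div_nonneg hγb.le huj.le
    rw [max_eq_left hlow, lt_min_iff, lt_min_iff, hS.lt_deltaUp_iff j hx0 huj,
      hS.lt_deltaUp_iff k hx0 huk]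
    have e1 : S.deltaLow θ (G j) * (S.η * S.Ψ * |θ| ^ 2 * G j) = S.γb := by
      rw [deltaLow, div_mul_cancel₀ _ huj.ne']
    have e2 : S.deltaLow θ (G j) * (S.η * S.Ψ * |θ| ^ 2 * G k) = S.γb * (G k / G j) := by
      rw [deltaLow, div_mul_eq_mul_div, mul_left_comm, mul_div_mul_left _ _ (by positivity),
        mul_div_assoc]
    have e3 : S.deltaLow θ (G j) < 1 ↔ S.γb / (S.η * S.Ψ) / G j < |θ| ^ 2 := by
      rw [deltaLow, div_lt_one huj, div_div, div_lt_iff₀ (by positivity)]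
      constructor <;> intro h <;> linarith
    rw [e1, e2, e3, add_comm S.γb]
    tauto
  · refine iff_of_false ?_ ?_
    · have hu0 : S.η * S.Ψ * |θ| ^ 2 * G j = 0 := by
        rcases (not_and_or.1 hθ) with h | h
        · rw [le_antisymm (not_lt.1 h) (by positivity)]; ring
        · rw [le_antisymm (not_lt.1 h) (hG j)]; ring
      have h1 : S.deltaLow θ (G j) = 0 := by rw [deltaLow, hu0, div_zero]
      have h2 : S.deltaUp j θ (τ j) (G j) = 0 := by
        rw [deltaUp, hu0, div_zero, div_zero, min_self]
      refine not_lt.2 (le_trans (b := (0 : ℝ)) ?_ ?_)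
      · exact (min_le_right _ _).trans ((min_le_left _ _).trans h2.le)
      · exact h1.ge.trans (le_max_left _ _)
    · rintro ⟨h1, -, -, h2⟩
      exact hθ ⟨(by positivity : (0 : ℝ) < S.γb / (S.η * S.Ψ) / G j).trans h2, h1⟩

/-! ### The closed form -/

/-- The real number given by the triple sum for the ordered pair `(j, k)`, with the Fox H-functions
replaced by the integrals to which they reduce. -/
theorem Admissible.tripleSum_eq (hS : S.Admissible) (j k : Fin 2) :
    S.tripleSum j k = (((∑ m ∈ Finset.range S.L, ∑ n ∈ Finset.range S.L,
      ∑ q ∈ Finset.range (n + 1),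
      S.Om j * S.β0 ^ m * S.χ k ^ q * Real.exp (-S.χ k) / (m.factorial * q.factorial * S.β k) *
        (((S.Om j + S.Om k) ^ ((m : ℤ) - 2)) *
          ∫ u in Set.Ioi (0 : ℝ), u ^ (1 - (m : ℝ)) * Real.exp (-u) *
          (1 + 1 / (S.β k * (S.Om j + S.Om k)) * u) ^ (-((n : ℝ) - q + 1)) *
            Real.exp (-(1 / (S.β0 * (S.Om j + S.Om k)) * u)⁻¹))) *
      erlangTail S.L (S.lam j * (S.piMax j / S.Ψ * (S.γb + 1))) : ℝ) : ℂ) := by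
  have hs := hS.βsum_pos j k
  have hβ := hS.β_pos k
  have hβ0 := hS.β0_pos
  have hγb := hS.γb_pos
  have harg : (S.γb + 1) * (S.lam j * S.piMax j / S.Ψ) =
      S.lam j * (S.piMax j / S.Ψ * (S.γb + 1)) := by ring
  have hx : 0 ≤ S.lam j * (S.piMax j / S.Ψ * (S.γb + 1)) := by
    have := hS.lam_pos j; have := hS.piMax_pos j; have := hS.Ψ_pos
    positivity
  have hL : 0 < S.L := by have := hS.two_le_L; omega
  rw [Complex.ofReal_mul, Complex.ofReal_sum, Finset.sum_mul, tripleSum]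
  refine Finset.sum_congr rfl fun m _ => ?_
  rw [Complex.ofReal_sum, Finset.sum_mul]
  refine Finset.sum_congr rfl fun n _ => ?_
  rw [Complex.ofReal_sum, Finset.sum_mul]
  refine Finset.sum_congr rfl fun q hq => ?_
  have hq' : q ≤ n := Nat.lt_succ_iff.1 (Finset.mem_range.1 hq)
  have hqr : (q : ℝ) ≤ n := by exact_mod_cast hq'
  rw [(sopFoxParams_hasValue m hq' (one_div_pos.2 (mul_pos hβ hs))
    (one_div_pos.2 (mul_pos hβ0 hs))).foxH_eq, harg, upperGamma_natCast hL hx]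
  simp only [← Complex.ofReal_mul]
  congr 1
  have h1 : Real.Gamma ((n : ℝ) - q + 1) ≠ 0 := (Real.Gamma_pos_of_pos (by linarith)).ne'
  have h2 : ((S.L - 1).factorial : ℝ) ≠ 0 := by positivity
  have h3 : (m.factorial : ℝ) ≠ 0 := by positivity
  have h4 : (q.factorial : ℝ) ≠ 0 := by positivity
  rw [← mul_assoc (1 / ((S.L - 1).factorial : ℝ)), one_div_mul_cancel h2, one_mul]
  simp only [βsum]
  generalize (∫ u in Set.Ioi (0 : ℝ), u ^ (1 - (m : ℝ)) * Real.exp (-u) *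
          (1 + 1 / (S.β k * (S.Om j + S.Om k)) * u) ^ (-((n : ℝ) - q + 1)) *
            Real.exp (-(1 / (S.β0 * (S.Om j + S.Om k)) * u)⁻¹)) = J
  generalize (S.Om j + S.Om k) ^ ((m : ℤ) - 2) = z
  field_simp

end SymbioticRSMA

/-! ### The outage probability -/

/-- Two disjoint blocks of an independent family are independent of each other. -/
theorem ProbabilityTheory.iIndepFun.indepFun_of_sumElim {W ι κ E : Type*} [MeasurableSpace W]
    {μ : Measure W} [IsProbabilityMeasure μ] [MeasurableSpace E] [Fintype ι] [Fintype κ]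
    {X : ι → W → E} {Y : κ → W → E} (h : iIndepFun (Sum.elim X Y) μ) (hX : ∀ i, Measurable (X i))
    (hY : ∀ i, Measurable (Y i)) : IndepFun (fun w i => X i w) (fun w i => Y i w) μ := by
  classical
  have h1 : ∀ i : ι, (Sum.inl i : ι ⊕ κ) ∈ Finset.univ.map Function.Embedding.inl := by simp
  have h2 : ∀ i : κ, (Sum.inr i : ι ⊕ κ) ∈ Finset.univ.map Function.Embedding.inr := by simp
  have h3 := h.indepFun_finset (Finset.univ.map Function.Embedding.inl)
    (Finset.univ.map Function.Embedding.inr) (by simp [Finset.disjoint_left])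
    (by rintro (i | i); exacts [hX i, hY i])
  exact h3.comp (φ := fun v i => v ⟨_, h1 i⟩) (ψ := fun v i => v ⟨_, h2 i⟩)
    (by fun_prop) (by fun_prop)

namespace SymbioticRSMA

theorem gain_nonneg {W : Type*} {L : ℕ} (h : Fin L → W → ℂ) (w : W) : 0 ≤ gain h w :=
  Finset.sum_nonneg fun _ _ => by positivity

variable {S : SymbioticRSMA} {W : Type*} [MeasurableSpace W] {μ : Measure W}
  [IsProbabilityMeasure μ]

theorem measurable_gain {L : ℕ} {h : Fin L → W → ℂ} (hm : ∀ l, Measurable (h l)) :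
    Measurable (gain h) := by
  unfold gain
  fun_prop

theorem measure_lt_gain {L : ℕ} {h : Fin L → W → ℂ} {r : ℝ} (hr : 0 < r)
    (hm : ∀ l, Measurable (h l)) (hl : ∀ l, HasLaw (fun w => ‖h l w‖ ^ 2) (expMeasure r) μ)
    (hi : iIndepFun h μ) {z : ℝ} (hz : 0 ≤ z) :
    μ {w | z < gain h w} = ENNReal.ofReal (erlangTail L (r * z)) := by
  have h1 := measure_lt_sum_of_exp (X := fun l w => ‖h l w‖ ^ 2) hr (fun l => by fun_prop)
    (fun l w => by positivity) hl (hi.comp (fun _ c => ‖c‖ ^ 2) fun _ => by fun_prop)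
    Finset.univ hz
  simpa [gain] using h1

section

variable {h : Fin 2 → Fin S.L → W → ℂ} {g : Fin 2 → W → ℂ} {θ : W → ℝ}

theorem Admissible.sop_eq (hS : S.Admissible) (h_meas : ∀ k l, Measurable (h k l))
    (g_meas : ∀ k, Measurable (g k)) (θ_meas : Measurable θ) :
    S.sop μ h g θ = 1 - μ.real (S.reflectionRangeNonempty h g θ) := by
  have hm := fun k => measurable_gain (h_meas k)
  have hE : MeasurableSet (S.reflectionRangeNonempty h g θ) := by
    unfold reflectionRangeNonempty deltaLow deltaUp
    refine measurableSet_lt ?_ ?_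
    · fun_prop
    · have := hm 0
      have := hm 1
      fun_prop
  rw [← probReal_compl_eq_one_sub hE, sop]
  congr 1
  ext w
  exact not_congr (hS.exists_sicRule_iff (fun k => gain_nonneg (h k) w) fun k => by positivity)

/-- The probability that reflection coefficients exist and user `j` has the weaker backscatter
link. -/
theorem Admissible.measure_range_nonempty_inter (hS : S.Admissible) {j k : Fin 2} (hjk : j ≠ k)
    (h_meas : ∀ k l, Measurable (h k l)) (g_meas : ∀ k, Measurable (g k)) (θ_meas : Measurable θ)
    (h_law : ∀ k l, HasLaw (fun w => ‖h k l w‖ ^ 2) (expMeasure (S.lam k)) μ)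
    (g_law : ∀ k, HasLaw (fun w => ‖g k w‖ ^ 2) (expMeasure (S.Om k)) μ)
    (indep : iIndepFun (Sum.elim (fun i : Fin 2 × Fin S.L => h i.1 i.2) g) μ)
    (hθ : IndepFun θ (fun w => ((fun k l => h k l w), (fun k => g k w))) μ)
    (hθt : ∀ z, 0 ≤ z →
      μ {w | z < |θ w| ^ 2} = ENNReal.ofReal (erlangTail S.L (S.lam0 * z))) :
    (μ (S.reflectionRangeNonempty h g θ ∩ {w | ‖g j w‖ ^ 2 < ‖g k w‖ ^ 2})).toReal =
      S.tripleSum j k := by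
  have hm := fun k => measurable_gain (h_meas k)
  have hγb := hS.γb_pos
  have hΨ := hS.Ψ_pos
  have hη := hS.η_pos
  have hπ := hS.piMax_pos
  have hset : S.reflectionRangeNonempty h g θ ∩ {w | ‖g j w‖ ^ 2 < ‖g k w‖ ^ 2} =
      {w | (0 < ‖g j w‖ ^ 2 ∧ ‖g j w‖ ^ 2 < ‖g k w‖ ^ 2) ∧
        S.piMax k / S.Ψ * (1 + S.γb * (‖g k w‖ ^ 2 / ‖g j w‖ ^ 2)) < gain (h k) w ∧
        S.piMax j / S.Ψ * (S.γb + 1) < gain (h j) w ∧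
        S.γb / (S.η * S.Ψ) / ‖g j w‖ ^ 2 < |θ w| ^ 2} := by
    ext w
    have key := fun hlt : ‖g j w‖ ^ 2 < ‖g k w‖ ^ 2 =>
      hS.range_nonempty_iff hjk (θ := θ w) (τ := fun k => gain (h k) w)
        (G := fun k => ‖g k w‖ ^ 2) (fun k => by positivity) hlt
    constructor
    · rintro ⟨h1, h2⟩
      have h3 := (key h2).1 h1
      exact ⟨⟨h3.1, h2⟩, h3.2⟩
    · rintro ⟨⟨h1, h2⟩, h3⟩
      exact ⟨(key h2).2 ⟨h1, h3⟩, h2⟩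
  -- independence of the gains of the two direct and the two backscatter links
  have hτt : ∀ k, ∀ z, 0 ≤ z →
      μ {w | z < gain (h k) w} = ENNReal.ofReal (erlangTail S.L (S.lam k * z)) := fun k z hz =>
    measure_lt_gain (hS.lam_pos k) (h_meas k) (h_law k)
      (indep.precomp (g := fun l : Fin S.L => Sum.inl (k, l)) fun a b hab => by simpa using hab) hz
  have h₀ : IndepFun (fun w => |θ w| ^ 2)
      (fun w => (gain (h j) w, gain (h k) w, ‖g j w‖ ^ 2, ‖g k w‖ ^ 2)) μ :=
    hθ.comp (φ := fun x => |x| ^ 2) (ψ := fun v : (Fin 2 → Fin S.L → ℂ) × (Fin 2 → ℂ) =>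
      ((∑ l, ‖v.1 j l‖ ^ 2), (∑ l, ‖v.1 k l‖ ^ 2), ‖v.2 j‖ ^ 2, ‖v.2 k‖ ^ 2))
      (by fun_prop) (by fun_prop)
  have h₁ : IndepFun (gain (h j)) (fun w => (gain (h k) w, ‖g j w‖ ^ 2, ‖g k w‖ ^ 2)) μ := by
    have h3 : iIndepFun (Sum.elim (h j) (Sum.elim (h k) g)) μ := by
      have h4 := indep.precomp
        (g := Sum.elim (fun l => Sum.inl (j, l)) (Sum.map (fun l : Fin S.L => (k, l)) id)) (by
          refine Function.Injective.sumElim (fun a b hab => by simpa using hab)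
            (Function.Injective.sumMap (fun a b hab => by simpa using hab) Function.injective_id) ?_
          rintro a (b | b)
          · simp [hjk]
          · simp)
      convert h4 using 1
      ext (i | i | i) <;> rfl
    exact (h3.indepFun_of_sumElim (h_meas j) (by rintro (i | i); exacts [h_meas _ _, g_meas _])).comp
      (φ := fun v : Fin S.L → ℂ => ∑ l, ‖v l‖ ^ 2)
      (ψ := fun v : Fin S.L ⊕ Fin 2 → ℂ =>
        ((∑ l, ‖v (Sum.inl l)‖ ^ 2), ‖v (Sum.inr j)‖ ^ 2, ‖v (Sum.inr k)‖ ^ 2))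
      (by fun_prop) (by fun_prop)
  have h₂ : IndepFun (gain (h k)) (fun w => (‖g j w‖ ^ 2, ‖g k w‖ ^ 2)) μ :=
    (indep.indepFun_of_sumElim (fun i => h_meas _ _) g_meas).comp
      (φ := fun v : Fin 2 × Fin S.L → ℂ => ∑ l, ‖v (k, l)‖ ^ 2)
      (ψ := fun v : Fin 2 → ℂ => (‖v j‖ ^ 2, ‖v k‖ ^ 2))
      (by fun_prop) (by fun_prop)
  have hX : IndepFun (fun w => ‖g j w‖ ^ 2) (fun w => ‖g k w‖ ^ 2) μ :=
    (indep.indepFun (i := Sum.inr j) (j := Sum.inr k) (by simpa using hjk)).comp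
      (φ := fun c : ℂ => ‖c‖ ^ 2) (ψ := fun c : ℂ => ‖c‖ ^ 2) (by fun_prop) (by fun_prop)
  have hSm : ∀ r : ℝ, Measurable fun z => ENNReal.ofReal (erlangTail S.L (r * z)) := fun r =>
    ((continuous_erlangTail S.L).measurable.comp (measurable_const_mul r)).ennreal_ofReal
  have main := measure_ordered_constraints (μ := μ) (X₁ := fun w => ‖g j w‖ ^ 2)
    (X₂ := fun w => ‖g k w‖ ^ 2) (T₀ := fun w => |θ w| ^ 2) (by fun_prop) (by fun_prop)
    (by fun_prop) (hm j) (hm k) (g_law j) (g_law k) (hSm S.lam0) (hSm (S.lam j)) (hSm (S.lam k))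
    hθt (hτt j) (hτt k) h₀ h₁ h₂ hX (a := S.γb / (S.η * S.Ψ)) (c := S.piMax j / S.Ψ * (S.γb + 1))
    (by positivity) (by have := hπ j; positivity)
    (t := fun x y => S.piMax k / S.Ψ * (1 + S.γb * (y / x))) (by fun_prop) (fun x y hx hxy => by
      have := hπ k; have := hx.trans hxy; positivity)
  have e0 : ∀ x : ℝ, S.lam0 * (S.γb / (S.η * S.Ψ) / x) = S.β0 / x := fun x => by
    rw [β0]; ring
  have e2 : ∀ x y : ℝ, S.lam k * (S.piMax k / S.Ψ * (1 + S.γb * (y / x))) =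
      S.χ k + S.β k * S.Om k * (y / x - 1) := fun x y => by
    have := (hS.Om_pos k).ne'
    generalize hq : y / x = q
    rw [χ, β]
    field_simp
    ring
  simp only [e0, e2] at main
  have hpos := lintegral_exp_mul_erlangTail_mul (hS.Om_pos k) (hS.Om_pos j) (hS.β_pos k) hS.β0_pos
    (hS.χ_pos k) S.L
  rw [hset, main, hpos, hS.tripleSum_eq j k, ENNReal.toReal_mul, ENNReal.toReal_ofReal,
    ENNReal.toReal_ofReal]
  · have := hS.lam_pos j
    have := hπ j
    exact erlangTail_nonneg _ (by positivity)
  · have hΩj := hS.Om_pos j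
    have hΩk := hS.Om_pos k
    have hβ := hS.β_pos k
    have hβ0 := hS.β0_pos
    have hχ := hS.χ_pos k
    refine Finset.sum_nonneg fun m _ => Finset.sum_nonneg fun n _ =>
      Finset.sum_nonneg fun q _ => mul_nonneg (by positivity) (mul_nonneg (by positivity) ?_)
    exact setIntegral_nonneg measurableSet_Ioi fun u (hu : 0 < u) => by positivity

/-- Both orders of the two backscatter links contribute a triple sum; ties are a null event. -/
theorem Admissible.sop_eq_closedForm (hS : S.Admissible)
    (h_meas : ∀ k l, Measurable (h k l)) (g_meas : ∀ k, Measurable (g k)) (θ_meas : Measurable θ)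
    (h_law : ∀ k l, HasLaw (fun w => ‖h k l w‖ ^ 2) (expMeasure (S.lam k)) μ)
    (g_law : ∀ k, HasLaw (fun w => ‖g k w‖ ^ 2) (expMeasure (S.Om k)) μ)
    (indep : iIndepFun (Sum.elim (fun i : Fin 2 × Fin S.L => h i.1 i.2) g) μ)
    (hθ : IndepFun θ (fun w => ((fun k l => h k l w), (fun k => g k w))) μ)
    (hθt : ∀ z, 0 ≤ z →
      μ {w | z < |θ w| ^ 2} = ENNReal.ofReal (erlangTail S.L (S.lam0 * z))) :
    (S.sop μ h g θ : ℂ) = S.closedForm := by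
  have hX : IndepFun (fun w => ‖g 0 w‖ ^ 2) (fun w => ‖g 1 w‖ ^ 2) μ :=
    (indep.indepFun (i := Sum.inr 0) (j := Sum.inr 1) (by simp)).comp
      (φ := fun c : ℂ => ‖c‖ ^ 2) (ψ := fun c : ℂ => ‖c‖ ^ 2) (by fun_prop) (by fun_prop)
  have hm : ∀ k, Measurable fun w => ‖g k w‖ ^ 2 := fun k => by fun_prop
  have htie : μ {w | ‖g 0 w‖ ^ 2 = ‖g 1 w‖ ^ 2} = 0 := by
    have h1 := hX.measure_eq_lintegral (hm 0) (hm 1) (A := {p : ℝ × ℝ | p.1 = p.2})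
      (measurableSet_eq_fun measurable_fst measurable_snd)
    simp only [Set.mem_ofPred_eq] at h1
    rw [h1, lintegral_eq_zero_iff' ?_]
    · refine Filter.Eventually.of_forall fun x => ?_
      have h2 := (g_law 1).measure_eq (p := fun y => x = y) (measurableSet_eq_fun measurable_const
        measurable_id)
      have h3 : {y : ℝ | x = y} = {x} := by ext y; simp [eq_comm]
      rw [h3, measure_singleton] at h2
      exact h2
    · exact (measurable_measure_prodMk_left (ν := μ) (s := {p : ℝ × W | p.1 = ‖g 1 p.2‖ ^ 2})
        (measurableSet_eq_fun measurable_fst ((hm 1).comp measurable_snd))).aemeasurable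
  set E := S.reflectionRangeNonempty h g θ with hE
  have hsplit : μ E = μ (E ∩ {w | ‖g 0 w‖ ^ 2 < ‖g 1 w‖ ^ 2}) +
      μ (E ∩ {w | ‖g 1 w‖ ^ 2 < ‖g 0 w‖ ^ 2}) := by
    rw [← measure_inter_add_sdiff E (measurableSet_lt (hm 0) (hm 1))]
    congr 1
    refine measure_congr ?_
    have hne : ∀ᵐ w ∂μ, ‖g 0 w‖ ^ 2 ≠ ‖g 1 w‖ ^ 2 := by
      rw [ae_iff]
      simpa only [not_not, ne_eq] using htie
    filter_upwards [hne] with w hw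
    refine propext (and_congr_right fun _ => ?_)
    change ¬ (‖g 0 w‖ ^ 2 < ‖g 1 w‖ ^ 2) ↔ ‖g 1 w‖ ^ 2 < ‖g 0 w‖ ^ 2
    rw [not_lt, le_iff_lt_or_eq]
    exact or_iff_left hw.symm
  have h01 := hS.measure_range_nonempty_inter (j := 0) (k := 1) (by decide) h_meas g_meas θ_meas
    h_law g_law indep hθ hθt
  have h10 := hS.measure_range_nonempty_inter (j := 1) (k := 0) (by decide) h_meas g_meas θ_meas
    h_law g_law indep hθ hθt
  rw [hS.sop_eq h_meas g_meas θ_meas, closedForm, ← h01, ← h10, measureReal_def, ← hE, hsplit,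
    ENNReal.toReal_add (measure_ne_top _ _) (measure_ne_top _ _)]
  push_cast
  ring

theorem Admissible.gammaCDF_eq (hS : S.Admissible) {z : ℝ} (hz : 0 ≤ z) :
    S.gammaCDF S.lam0 z = 1 - erlangTail S.L (S.lam0 * z) := by
  have hL : 0 < S.L := by have := hS.two_le_L; omega
  have h2 : ((S.L - 1).factorial : ℝ) ≠ 0 := by positivity
  rw [gammaCDF, upperGamma_natCast hL (mul_nonneg hS.lam0_pos.le hz), mul_div_cancel_left₀ _ h2]

end

end SymbioticRSMA

theorem theorem1 (S : SymbioticRSMA) (hS : S.Admissible)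
    {W : Type*} [MeasurableSpace W] (μ : MeasureTheory.Measure W)
    [MeasureTheory.IsProbabilityMeasure μ]
    -- the channels: base station to backscatter device, base station to users,
    -- backscatter device to users
    (h0 : Fin S.L → W → ℂ) (h : Fin 2 → Fin S.L → W → ℂ) (g : Fin 2 → W → ℂ)
    (h0_meas : ∀ l, Measurable (h0 l)) (h_meas : ∀ k l, Measurable (h k l))
    (g_meas : ∀ k, Measurable (g k))
    -- Rayleigh fading with independent channel coefficients
    (h0_law : ∀ l, ProbabilityTheory.HasLaw (fun w => ‖h0 l w‖ ^ 2)
      (ProbabilityTheory.expMeasure S.lam0) μ)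
    (h_law : ∀ k l, ProbabilityTheory.HasLaw (fun w => ‖h k l w‖ ^ 2)
      (ProbabilityTheory.expMeasure (S.lam k)) μ)
    (g_law : ∀ k, ProbabilityTheory.HasLaw (fun w => ‖g k w‖ ^ 2)
      (ProbabilityTheory.expMeasure (S.Om k)) μ)
    (indep : ProbabilityTheory.iIndepFun
      (Sum.elim h0 (Sum.elim (fun i : Fin 2 × Fin S.L => h i.1 i.2) g)) μ) :
    -- the bivariate Fox H-functions of the closed form are well defined
    (∀ j k : Fin 2, j ≠ k → ∀ m < S.L, ∀ n < S.L, ∀ q ≤ n,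
      (sopFoxParams m n q).HasValue
        ((1 / (S.β k * S.βsum j k) : ℝ) : ℂ) ((1 / (S.β0 * S.βsum j k) : ℝ) : ℂ)
        ((sopFoxParams m n q).foxH
          ((1 / (S.β k * S.βsum j k) : ℝ) : ℂ) ((1 / (S.β0 * S.βsum j k) : ℝ) : ℂ))) ∧
    -- any gain-control factor whose square has the gamma distribution function
    (∀ θ : W → ℝ, Measurable θ →
      ProbabilityTheory.IndepFun θ (fun w => ((fun k l => h k l w), (fun k => g k w))) μ →
      (∀ z : ℝ, 0 ≤ z → μ.real {w | |θ w| ^ 2 ≤ z} = S.gammaCDF S.lam0 z) →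
        S.sop μ h g θ = 1 - μ.real (S.reflectionRangeNonempty h g θ) ∧
        (S.sop μ h g θ : ℂ) = S.closedForm) ∧
    -- in particular the composite gain `|θ|² = ∑ |h_{0,l}|²`
    (S.sop μ h g (fun w => Real.sqrt (SymbioticRSMA.gain h0 w)) : ℂ) = S.closedForm := by
  have indep' : iIndepFun (Sum.elim (fun i : Fin 2 × Fin S.L => h i.1 i.2) g) μ :=
    indep.precomp (g := Sum.inr) Sum.inr_injective
  refine ⟨fun j k _ m _ n _ q hq => ?_, fun θ hθm hθ hcdf => ⟨hS.sop_eq h_meas g_meas hθm, ?_⟩, ?_⟩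
  · have hv := sopFoxParams_hasValue m hq (one_div_pos.2 (mul_pos (hS.β_pos k) (hS.βsum_pos j k)))
      (one_div_pos.2 (mul_pos hS.β0_pos (hS.βsum_pos j k)))
    rw [hv.foxH_eq]
    exact hv
  · refine hS.sop_eq_closedForm h_meas g_meas hθm h_law g_law indep' hθ fun z hz => ?_
    have hms : MeasurableSet {w | |θ w| ^ 2 ≤ z} := measurableSet_le (by fun_prop) measurable_const
    have h1 : {w | z < |θ w| ^ 2} = {w | |θ w| ^ 2 ≤ z}ᶜ := by ext w; simp
    rw [h1, ← ENNReal.ofReal_toReal (measure_ne_top μ _), ← measureReal_def,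
      probReal_compl_eq_one_sub hms, hcdf z hz, hS.gammaCDF_eq hz, sub_sub_cancel]
  · have hgm := SymbioticRSMA.measurable_gain h0_meas
    refine hS.sop_eq_closedForm h_meas g_meas (by fun_prop) h_law g_law indep' ?_ fun z hz => ?_
    · exact (indep.indepFun_of_sumElim h0_meas
        (by rintro (i | i); exacts [h_meas _ _, g_meas _])).comp
        (φ := fun v : Fin S.L → ℂ => Real.sqrt (∑ l, ‖v l‖ ^ 2))
        (ψ := fun v : Fin 2 × Fin S.L ⊕ Fin 2 → ℂ =>
          ((fun k l => v (Sum.inl (k, l))), (fun k => v (Sum.inr k))))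
        (by fun_prop) (by fun_prop)
    · simp only [sq_abs, Real.sq_sqrt (SymbioticRSMA.gain_nonneg h0 _)]
      exact SymbioticRSMA.measure_lt_gain hS.lam0_pos h0_meas h0_law
        (indep.precomp (g := Sum.inl) Sum.inl_injective) hz
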